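/- Let $\mathcal{L}=\langle 0,1,\cdot,{}^{-1},<,R_2,R_3,\ldots\rangle$ be the first-order language with constants $0,1$, a binary function symbol $\cdot$, a unary function symbol ${}^{-1}$, a binary relation symbol $<$ and unary relation symbols $R_n$ for $n\geq 2$. Interpret it in $\mathbb{Q}$ in the usual way, with $0^{-1}=0$ and with $R_n(x)$ meaning that $x=y^n$ for some $y\in\mathbb{Q}$. A theory is called decidable if the set of Gödel numbers of its sentences is recursive. Then: 1. The structure $\langle\mathbb{Q},\mathcal{L}\rangle$ admits quantifier elimination: every $\mathcal{L}$-formula $\varphi(x_1,\ldots,x_k)$, $k\geq 0$, is equivalent in $\mathbb{Q}$ to a quantifier-free $\mathcal{L}$-formula $\psi(x_1,\ldots,x_k)$. 2. There is an algorithm that decides, given $r\in\mathbb{Q}$ and $n\in\mathbb{N}$, whether $r$ is an $n$-th power of a rational number. 3. There is an algorithm that decides, given a quantifier-free $\mathcal{L}$-formula $\varphi(x_1,\ldots,x_k)$, $k\geq 0$, and rationals $r_1,\ldots,r_k$, whether $\varphi(r_1,\ldots,r_k)$ holds in $\mathbb{Q}$; in particular the truth of quantifier-free $\mathcal{L}$-sentences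 in $\mathbb{Q}$ is decidable. 4. The complete theory of $\langle\mathbb{Q},\mathcal{L}\rangle$ is decidable. 5. The complete theory of $\langle\mathbb{Q},\cdot,\leq\rangle$ is decidable. 6. Addition is not definable in $\langle\mathbb{Q},\cdot,\leq\rangle$: no first-order formula $\varphi(x,y,z)$ in the language $\langle\cdot,\leq\rangle$, without parameters, defines the relation $x+y=z$ in $\mathbb{Q}$. -/

import Mathlib

open FirstOrder FirstOrder.Language

/-! ### The two languages and their interpretations in the rationals -/

/-- Function symbols of `⟨·, ≤⟩`: one binary symbol. -/
inductive MulOrdFunc : ℕ → Type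
  | mul : MulOrdFunc 2

/-- Relation symbols of `⟨·, ≤⟩`: one binary symbol. -/
inductive MulOrdRel : ℕ → Type
  | le : MulOrdRel 2

/-- The language `⟨·, ≤⟩`. -/
def mulOrdLang : Language where
  Functions := MulOrdFunc
  Relations := MulOrdRel

/-- The structure `⟨ℚ, ·, ≤⟩`. -/
instance ratMulOrdStructure : mulOrdLang.Structure ℚ where
  funMap := fun f x => match f, x with
    | .mul, x => x 0 * x 1
  RelMap := fun r x => match r, x with
    | .le, x => x 0 ≤ x 1

/-- Function symbols `0, 1, ·, ⁻¹`. -/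
inductive PowFunc : ℕ → Type
  | zero : PowFunc 0
  | one : PowFunc 0
  | mul : PowFunc 2
  | inv : PowFunc 1

/-- Relation symbols `<, R₂, R₃, …`; the symbol `Rₙ` exists for `n ≥ 2` only. -/
inductive PowRel : ℕ → Type
  | lt : PowRel 2
  | isPow (n : ℕ) (hn : 2 ≤ n) : PowRel 1

/-- The language `ℒ = ⟨0, 1, ·, ⁻¹, <, R₂, R₃, …⟩`. -/
def powLang : Language where
  Functions := PowFunc
  Relations := PowRel

/-- The structure `⟨ℚ, ℒ⟩`: `Rₙ(x)` says that `x` is the `n`-th power of a rational number,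
and the inverse is made total by `0⁻¹ = 0`. -/
instance ratPowStructure : powLang.Structure ℚ where
  funMap := fun f x => match f, x with
    | .zero, _ => 0
    | .one, _ => 1
    | .mul, x => x 0 * x 1
    | .inv, x => (x 0)⁻¹
  RelMap := fun r x => match r, x with
    | .lt, x => x 0 < x 1
    | .isPow n _, x => ∃ y : ℚ, x 0 = y ^ n

/-! ### Quantifier elimination -/

/-- `M` admits quantifier elimination in `L`: every first-order formula is equivalent in `M` to a
quantifier-free formula with the same free variables. -/
def AdmitsQE (L : Language) (M : Type) [L.Structure M] : Prop :=
  ∀ (n : ℕ) (φ : L.Formula (Fin n)), ∃ ψ : L.Formula (Fin n),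
    ψ.IsQF ∧ ∀ v : Fin n → M, φ.Realize v ↔ ψ.Realize v

/-! ### Gödel numbering -/

/-- An injective numbering of the function symbols and of the relation symbols of a language
(the number determines the arity). -/
structure SymbolNumbering (L : Language) where
  func : (Σ k, L.Functions k) → ℕ
  func_injective : Function.Injective func
  rel : (Σ k, L.Relations k) → ℕ
  rel_injective : Function.Injective rel

/-- Gödel number of a term in the variables `x₀, …, xₙ₋₁`. -/
def termCode {L : Language} (N : SymbolNumbering L) {n : ℕ} : L.Term (Empty ⊕ Fin n) → ℕ
  | .var (.inr i) => Nat.pair 0 i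
  | .func f ts =>
      Nat.pair 1 (Nat.pair (N.func ⟨_, f⟩) (Encodable.encode (List.ofFn fun i => termCode N (ts i))))

/-- Gödel number of a formula whose free variables are among `x₀, …, xₙ₋₁`; the quantifier of
`all φ` binds `xₙ` in `φ`. For `n = 0` this numbers the sentences. -/
def formulaCode {L : Language} (N : SymbolNumbering L) : {n : ℕ} → L.BoundedFormula Empty n → ℕ
  | _, .falsum => Nat.pair 0 0
  | _, .equal t₁ t₂ => Nat.pair 1 (Nat.pair (termCode N t₁) (termCode N t₂))
  | _, .rel R ts =>
      Nat.pair 2 (Nat.pair (N.rel ⟨_, R⟩) (Encodable.encode (List.ofFn fun i => termCode N (ts i))))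
  | _, .imp φ ψ => Nat.pair 3 (Nat.pair (formulaCode N φ) (formulaCode N ψ))
  | _, .all φ => Nat.pair 4 (formulaCode N φ)

theorem termCode_injective {L : Language} (N : SymbolNumbering L) {n : ℕ} :
    Function.Injective (termCode N (n := n)) := by
  intro s
  induction s with
  | var i =>
    rcases i with i | i
    · exact i.elim
    · rintro ((j | j) | _) h
      · exact j.elim
      · simp only [termCode, Nat.pair_eq_pair, true_and] at h
        rw [Fin.ext h]
      · simp [termCode, Nat.pair_eq_pair] at h
  | func f ts ih =>
    rintro ((j | j) | ⟨g, us⟩) h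
    · exact j.elim
    · simp [termCode, Nat.pair_eq_pair] at h
    · simp only [termCode, Nat.pair_eq_pair, true_and] at h
      obtain ⟨h1, h2⟩ := h
      cases N.func_injective h1
      have h3 := List.ofFn_injective (Encodable.encode_injective h2)
      congr 1
      funext i
      exact ih i (congrFun h3 i)

theorem formulaCode_injective {L : Language} (N : SymbolNumbering L) {n : ℕ} :
    Function.Injective (formulaCode N (n := n)) := by
  intro φ
  induction φ with
  | falsum => intro ψ h; cases ψ <;> simp_all [formulaCode, Nat.pair_eq_pair]
  | equal t₁ t₂ =>
    intro ψ h
    cases ψ <;> simp_all [formulaCode, Nat.pair_eq_pair, (termCode_injective N).eq_iff]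
  | rel R ts =>
    intro ψ h
    cases ψ with
    | rel S us =>
      simp only [formulaCode, Nat.pair_eq_pair, true_and] at h
      obtain ⟨h1, h2⟩ := h
      cases N.rel_injective h1
      have h3 := List.ofFn_injective (Encodable.encode_injective h2)
      congr 1
      funext i
      exact termCode_injective N (congrFun h3 i)
    | _ => simp [formulaCode, Nat.pair_eq_pair] at h
  | imp φ₁ φ₂ ih1 ih2 =>
    intro ψ h
    cases ψ with
    | imp ψ₁ ψ₂ =>
      simp only [formulaCode, Nat.pair_eq_pair, true_and] at h
      rw [ih1 h.1, ih2 h.2]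
    | _ => simp [formulaCode, Nat.pair_eq_pair] at h
  | all φ ih =>
    intro ψ h
    cases ψ with
    | all ψ =>
      simp only [formulaCode, Nat.pair_eq_pair, true_and] at h
      rw [ih h]
    | _ => simp [formulaCode, Nat.pair_eq_pair] at h

/-- The numbering of the symbols of `⟨·, ≤⟩`. -/
def mulOrdNumbering : SymbolNumbering mulOrdLang where
  func := fun _ => 0
  func_injective := by rintro ⟨_, ⟨⟩⟩ ⟨_, ⟨⟩⟩ _; rfl
  rel := fun _ => 0
  rel_injective := by rintro ⟨_, ⟨⟩⟩ ⟨_, ⟨⟩⟩ _; rfl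

/-- Numbers of the function symbols of `ℒ`. -/
def powFuncNumber : (Σ k, powLang.Functions k) → ℕ
  | ⟨_, .zero⟩ => 0
  | ⟨_, .one⟩ => 1
  | ⟨_, .mul⟩ => 2
  | ⟨_, .inv⟩ => 3

/-- Numbers of the relation symbols of `ℒ`: `<` has number `0` and `Rₙ` has number `n`. -/
def powRelNumber : (Σ k, powLang.Relations k) → ℕ
  | ⟨_, .lt⟩ => 0
  | ⟨_, .isPow n _⟩ => n

/-- The numbering of the symbols of `ℒ`. -/
def powNumbering : SymbolNumbering powLang where
  func := powFuncNumber
  func_injective := by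
    rintro ⟨_, ⟨⟩⟩ ⟨_, ⟨⟩⟩ h <;> first | rfl | simp [powFuncNumber] at h
  rel := powRelNumber
  rel_injective := by
    rintro ⟨_, _ | ⟨n, hn⟩⟩ ⟨_, _ | ⟨m, hm⟩⟩ h <;> simp only [powRelNumber] at h
    · rfl
    · omega
    · omega
    · subst h; rfl

/-! ### Decidability -/

/-- A theory is decidable: the set of Gödel numbers of its sentences is recursive. -/
def DecidableTheory {L : Language} (N : SymbolNumbering L) (T : L.Theory) : Prop :=
  ComputablePred fun m : ℕ => ∃ φ ∈ T, formulaCode N φ = m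

/-- The rational number `a / (b + 1)` given by the pair `(a, b)`; every rational number arises. -/
def fracVal (p : ℤ × ℕ) : ℚ := (p.1 : ℚ) / ((p.2 : ℚ) + 1)

/-! A nonzero rational is a sign together with an element of the ordered group G of positive
rationals, written additively as `PosRat`. Up to zeros and signs, every term is a monomial. So an
atomic formula speaks of signs, of the positivity of integral combinations of the magnitudes, and of
their divisibility by some m. `RatEquiv N` says that two tuples agree on all such conditions whose
coefficients and moduli are at most N.

The heart is a quantitative back-and-forth. If a and b agree at level 2·N!·N², then every x has a
partner y such that (a, x) and (b, y) agree at level N (`LinEquiv.exists_ext`). Put M = N!. If M•x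
is a small combination of a, the corresponding combination of b is divisible by M, and y is its M-th
part. Otherwise M•x lies in a cut, which is transported to an interval over b, and what remains is
to realise the divisibility behaviour of x modulo M. For this y = h + r•q + M•z is taken, where h
fixes the relation that x satisfies modulo M, the generic q excludes further relations, and z is
free. Two properties of G make this possible: a new prime is generic over any finite tuple
(`PosRat.exists_isGeneric`), and K-th powers are dense (`PosRat.exists_nsmul_between`).

By induction on formulas, every formula is invariant under some `RatEquiv N`
(`AtomicInvariant.realize_iff`, `AtomicInvariant.exists_level`). Quantifier elimination follows,
because `RatEquiv N` is given by finitely many quantifier-free conditions. Addition is not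
definable, because (1, 1, 2) and (1, 1, 3) agree at every level.

Decidability comes from the heights of the witnesses: y can be chosen below a primitive recursive
bound (`witnessBound`), so every quantifier may be restricted to a finite set of rationals
(`AtomicInvariant.forall_iff`). Evaluating formulas on natural number codes with bounded quantifiers
is then primitive recursive, and the evaluator also recognises which numbers are Gödel numbers. -/

/-! ### Back-and-forth in ordered abelian groups. -/

section OrderedGroup

variable {ι G : Type} [Fintype ι] [AddCommGroup G]

/-- The integral linear combination `∑ eᵢ aᵢ`. -/
def intLin (e : ι → ℤ) (a : ι → G) : G := ∑ i, e i • a i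

theorem intLin_add (e f : ι → ℤ) (a : ι → G) : intLin (e + f) a = intLin e a + intLin f a := by
  simp [intLin, add_smul, Finset.sum_add_distrib]

theorem intLin_smul (k : ℤ) (e : ι → ℤ) (a : ι → G) : intLin (k • e) a = k • intLin e a := by
  simp [intLin, mul_smul, Finset.smul_sum]

theorem intLin_zero (a : ι → G) : intLin 0 a = 0 := by
  simp [intLin]

/-- The divisibility of an integral linear combination by `M` depends on the coefficients modulo
`M` only. -/
theorem exists_smul_eq_intLin_emod (M : ℕ) (e : ι → ℤ) (a : ι → G) :
    (∃ g, M • g = intLin e a) ↔ ∃ g, M • g = intLin (fun i => e i % M) a := by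
  have h : intLin e a = intLin (fun i => e i % M) a + M • intLin (fun i => e i / M) a := by
    rw [← natCast_zsmul, ← intLin_smul, ← intLin_add]
    congr 1
    funext i
    simp [Int.emod_add_mul_ediv]
  constructor
  · rintro ⟨g, hg⟩
    exact ⟨g - intLin (fun i => e i / M) a, by rw [smul_sub, hg, h]; abel⟩
  · rintro ⟨g, hg⟩
    exact ⟨g + intLin (fun i => e i / M) a, by rw [smul_add, hg, h]⟩

/-- The divisibility conditions by `M` on `(a, x)` are controlled by the least positive multiple of
`x` which lies in the subgroup generated by `a`, modulo `M`. -/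
theorem exists_divisibility_data {M : ℕ} (hM : 0 < M) (a : ι → G) (x : G) :
    ∃ (j r : ℕ) (f : ι → ℤ), j * r = M ∧ (∀ i, 0 ≤ f i ∧ f i < M) ∧ (∃ h, j • h = intLin f a) ∧
      ∀ (k : ℤ) (e : ι → ℤ), (∃ g, M • g = k • x + intLin e a) ↔
        ∃ s : ℤ, k = j * s ∧ ∃ g, M • g = intLin (e + s • f) a := by
  -- J consists of the k for which k•x lies in the subgroup generated by a and the M-multiples. It
  -- contains M, so its nonnegative generator j divides M.
  let J : AddSubgroup ℤ :=
    { carrier := {k | ∃ (e : ι → ℤ) (g : G), M • g = k • x + intLin e a}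
      zero_mem' := ⟨0, 0, by simp [intLin_zero]⟩
      add_mem' := by
        rintro k l ⟨e, g, h⟩ ⟨e', g', h'⟩
        exact ⟨e + e', g + g', by rw [smul_add, h, h', intLin_add, add_smul]; abel⟩
      neg_mem' := by
        rintro k ⟨e, g, h⟩
        exact ⟨(-1 : ℤ) • e, -g, by rw [smul_neg, h, intLin_smul]; module⟩ }
  have hMJ : (M : ℤ) ∈ J := ⟨0, x, by simp [intLin_zero]⟩
  obtain ⟨d, hd⟩ := Int.subgroup_cyclic J
  have hJ : ∀ k, k ∈ J ↔ (d.natAbs : ℤ) ∣ k := by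
    intro k
    rw [hd, ← AddSubgroup.zmultiples_eq_closure, Int.mem_zmultiples_iff, Int.natAbs_dvd]
  obtain ⟨r, hr⟩ : d.natAbs ∣ M := by exact_mod_cast (hJ M).1 hMJ
  set j := d.natAbs
  have hj : 0 < j := Nat.pos_of_ne_zero fun h => by rw [h] at hr; omega
  have hr0 : 0 < r := Nat.pos_of_ne_zero fun h => by rw [h] at hr; omega
  obtain ⟨f', g', hg'⟩ : (j : ℤ) ∈ J := (hJ j).2 dvd_rfl
  -- The relation for j is solved for j•x and its coefficients are reduced modulo M, the quotients
  -- going into M•g. The bound on f later bounds the height of h.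
  obtain ⟨f, g, hf, hg⟩ : ∃ (f : ι → ℤ) (g : G), (∀ i, 0 ≤ f i ∧ f i < M) ∧
      j • x = intLin f a + M • g := by
    have h1 : ∃ g, M • g = intLin ((-1 : ℤ) • f') a - j • x :=
      ⟨-g', by rw [smul_neg, hg', intLin_smul, neg_smul, one_smul, natCast_zsmul]; abel⟩
    have h2 : intLin ((-1 : ℤ) • f') a = intLin (fun i => ((-1 : ℤ) • f') i % M) a +
        M • intLin (fun i => ((-1 : ℤ) • f') i / M) a := by
      rw [← natCast_zsmul, ← intLin_smul, ← intLin_add]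
      congr 1
      funext i
      simp only [Pi.add_apply, Pi.smul_apply, smul_eq_mul]
      exact (Int.emod_add_mul_ediv _ _).symm
    obtain ⟨g, hg⟩ := h1
    refine ⟨fun i => ((-1 : ℤ) • f') i % M, intLin (fun i => ((-1 : ℤ) • f') i / M) a - g,
      fun i => ⟨Int.emod_nonneg _ ?_,
      Int.emod_lt_of_pos _ ?_⟩, ?_⟩
    · omega
    · omega
    · rw [smul_sub, hg, h2]; abel
  -- Since j * r = M, multiplying x - r•g by j removes exactly the term M•g.
  refine ⟨j, r, f, hr.symm, hf, ⟨x - r • g, ?_⟩, fun k e => ?_⟩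
  · rw [smul_sub, hg, ← mul_smul, ← hr]; abel
  · constructor
    · rintro ⟨g₁, hg₁⟩
      obtain ⟨s, rfl⟩ := (hJ k).1 ⟨e, g₁, hg₁⟩
      refine ⟨s, rfl, g₁ - s • g, ?_⟩
      rw [smul_sub, hg₁, intLin_add, intLin_smul, mul_comm, mul_smul, natCast_zsmul, hg, smul_add,
        smul_comm M s g]
      abel
    · rintro ⟨s, rfl, g₁, hg₁⟩
      refine ⟨g₁ + s • g, ?_⟩
      rw [smul_add, hg₁, intLin_add, intLin_smul, mul_comm, mul_smul, natCast_zsmul, hg, smul_add,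
        smul_comm M s g]
      abel

/-- An element whose multiples are as independent as possible from the tuple `b`. -/
def IsGeneric (b : ι → G) (q : G) : Prop :=
  ∀ (m : ℕ) (j : ℤ) (f : ι → ℤ) (g : G), m • g = j • q + intLin f b → (m : ℤ) ∣ j

/-- The right-hand side is that of `exists_divisibility_data`, so h + r•q + M•z behaves over b as x
does over a, and z stays free for placing it in an interval. Multiplied by j, the element is intLin
f b plus an M-multiple. A relation with coefficient k thus yields one for q with coefficient k * M
and modulus j * M, and genericity forces j ∣ k. -/
theorem IsGeneric.divisible_iff {b : ι → G} {q : G} (hq : IsGeneric b q) {M j r : ℕ} (hM : 0 < M)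
    (hjr : j * r = M) {f : ι → ℤ} {h : G} (hh : j • h = intLin f b) (z : G) (k : ℤ) (e : ι → ℤ) :
    (∃ g, M • g = k • (h + r • q + M • z) + intLin e b) ↔
      ∃ s : ℤ, k = j * s ∧ ∃ g, M • g = intLin (e + s • f) b := by
  have key : j • (h + r • q + M • z) = intLin f b + M • (q + j • z) := by
    rw [smul_add, smul_add, hh, ← mul_smul, hjr, smul_add, smul_comm j M z]; abel
  constructor
  · rintro ⟨g, hg⟩
    have h1 : (j * M) • (g - k • z) = (k * M) • q + intLin (k • f + (j : ℤ) • e) b := by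
      have h2 : j • (M • g) = j • (k • (h + r • q + M • z) + intLin e b) := by rw [hg]
      rw [smul_add, smul_comm j k, key] at h2
      rw [smul_sub, mul_smul, h2, intLin_add, intLin_smul, intLin_smul]
      module
    have h2 := hq _ _ _ _ h1
    rw [Nat.cast_mul] at h2
    obtain ⟨s, rfl⟩ := Int.dvd_of_mul_dvd_mul_right (by omega) h2
    refine ⟨s, rfl, g - s • (q + j • z), ?_⟩
    rw [smul_sub, hg, mul_comm, mul_smul, natCast_zsmul, key, intLin_add, intLin_smul]
    module
  · rintro ⟨s, rfl, g, hg⟩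
    refine ⟨g + s • (q + j • z), ?_⟩
    rw [smul_add M, hg, mul_comm, mul_smul, natCast_zsmul, key, intLin_add, intLin_smul]
    module

variable [LinearOrder G]

/-- Two tuples satisfy the same order and divisibility conditions of complexity at most `N`. -/
def LinEquiv (N : ℕ) (a b : ι → G) : Prop :=
  ∀ e : ι → ℤ, (∀ i, |e i| ≤ N) →
    (0 < intLin e a ↔ 0 < intLin e b) ∧
    ∀ m : ℕ, 0 < m → m ≤ N → ((∃ g, m • g = intLin e a) ↔ ∃ g, m • g = intLin e b)

/-- The tuples `(a, x)` and `(b, y)` satisfy the same order and divisibility conditions of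
complexity at most `N`. -/
def LinEquivExt (N : ℕ) (a : ι → G) (x : G) (b : ι → G) (y : G) : Prop :=
  ∀ (k : ℤ) (e : ι → ℤ), |k| ≤ N → (∀ i, |e i| ≤ N) →
    (0 < k • x + intLin e a ↔ 0 < k • y + intLin e b) ∧
    ∀ m : ℕ, 0 < m → m ≤ N →
      ((∃ g, m • g = k • x + intLin e a) ↔ ∃ g, m • g = k • y + intLin e b)

theorem LinEquiv.mono {N N' : ℕ} (h : N ≤ N') {a b : ι → G} (hab : LinEquiv N' a b) :
    LinEquiv N a b := fun e he =>
  have h' : (N : ℤ) ≤ N' := by exact_mod_cast h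
  ⟨(hab e fun i => (he i).trans h').1, fun m hm hmN =>
    (hab e fun i => (he i).trans h').2 m hm (hmN.trans h)⟩

/-- No bound on e is needed: only its residues modulo M matter, and they are below N. -/
theorem LinEquiv.divisible_iff {N M : ℕ} (hM : 0 < M) (hMN : M ≤ N) {a b : ι → G}
    (hab : LinEquiv N a b) (e : ι → ℤ) :
    (∃ g, M • g = intLin e a) ↔ ∃ g, M • g = intLin e b := by
  rw [exists_smul_eq_intLin_emod, exists_smul_eq_intLin_emod M e b]
  refine (hab _ fun i => ?_).2 M hM hMN
  have h1 : 0 ≤ e i % M := Int.emod_nonneg _ (by omega)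
  have h2 : e i % M < M := Int.emod_lt_of_pos _ (by omega)
  rw [abs_of_nonneg h1]
  omega

variable [IsOrderedAddMonoid G]

theorem nsmul_pos_iff_pos {n : ℕ} (hn : 0 < n) (x : G) : 0 < n • x ↔ 0 < x := by
  constructor
  · intro h
    by_contra hx
    exact absurd h (not_lt.2 (nsmul_nonpos (not_lt.1 hx) n))
  · exact fun h => nsmul_pos h hn.ne'

theorem exists_nsmul_eq_nsmul_iff {r : ℕ} (hr : 0 < r) (m : ℕ) (x : G) :
    (∃ g, (r * m) • g = r • x) ↔ ∃ g, m • g = x := by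
  constructor
  · rintro ⟨g, hg⟩
    exact ⟨g, nsmul_right_injective hr.ne' (by simpa [mul_smul] using hg)⟩
  · rintro ⟨g, rfl⟩
    exact ⟨g, by rw [mul_smul]⟩

/-- The algebraic case of the forth step. Multiplication by M is injective and preserves positivity,
and it turns each condition on (a, x) into one on a alone, with coefficients k•f + M•e of size at
most 2MN² and moduli M * m at most MN. -/
theorem LinEquiv.ext_of_nsmul_eq {N N' M : ℕ} (hM : 0 < M) (hN' : 2 * M * N ^ 2 ≤ N')
    (hN'' : N * M ≤ N') {a b : ι → G} (hab : LinEquiv N' a b) {f : ι → ℤ}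
    (hf : ∀ i, |f i| ≤ M * N) {x y : G} (hx : M • x = intLin f a) (hy : M • y = intLin f b) :
    LinEquivExt N a x b y := by
  intro k e hk he
  have key : ∀ (c : ι → G) (z : G), M • z = intLin f c →
      M • (k • z + intLin e c) = intLin (k • f + (M : ℤ) • e) c := by
    intro c z hz
    rw [intLin_add, intLin_smul, intLin_smul, ← hz, smul_add, smul_comm, natCast_zsmul]
  have hbd : ∀ i, |(k • f + (M : ℤ) • e) i| ≤ N' := by
    intro i
    simp only [Pi.add_apply, Pi.smul_apply, smul_eq_mul]
    have h1 : |k * f i| ≤ N * (M * N) := by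
      rw [abs_mul]; exact mul_le_mul hk (hf i) (abs_nonneg _) (by positivity)
    have h2 : |(M : ℤ) * e i| ≤ M * N := by
      rw [abs_mul, Nat.abs_cast]; exact mul_le_mul_of_nonneg_left (he i) (by positivity)
    have h3 : (N : ℤ) ≤ N ^ 2 := by exact_mod_cast Nat.le_self_pow (by norm_num) N
    have h4 : (M : ℤ) * N ≤ M * N ^ 2 := mul_le_mul_of_nonneg_left h3 (by positivity)
    have h5 : (2 * M * N ^ 2 : ℤ) ≤ N' := by exact_mod_cast hN'
    have := abs_add_le (k * f i) (M * e i)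
    nlinarith
  refine ⟨?_, fun m hm hmN => ?_⟩
  · rw [← nsmul_pos_iff_pos hM, key a x hx, ← nsmul_pos_iff_pos hM (k • y + _), key b y hy]
    exact (hab _ hbd).1
  · rw [← exists_nsmul_eq_nsmul_iff hM, key a x hx, ← exists_nsmul_eq_nsmul_iff hM _ (k • y + _),
      key b y hy]
    exact (hab _ hbd).2 _ (Nat.mul_pos hM hm)
      ((Nat.mul_le_mul_left M hmN).trans (by rwa [Nat.mul_comm M N]))

/-- The cut case of the forth step. As M is a common multiple of 1, …, N, a condition with
coefficient ±n on x can be multiplied by M / n and then compares M•x with a combination of size at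
most MN. Likewise divisibility by m becomes divisibility by M. -/
theorem LinEquiv.ext_of_cut {N M : ℕ} (hM : 0 < M) (hNM : ∀ m, 0 < m → m ≤ N → m ∣ M)
    {a b : ι → G} (hab : LinEquiv N a b) {x y : G}
    (hlo : ∀ f : ι → ℤ, (∀ i, |f i| ≤ M * N) → (intLin f a < M • x ↔ intLin f b < M • y))
    (hup : ∀ f : ι → ℤ, (∀ i, |f i| ≤ M * N) → (M • x < intLin f a ↔ M • y < intLin f b))
    (hdiv : ∀ (j : ℤ) (f : ι → ℤ), (∃ g, M • g = j • x + intLin f a) ↔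
      ∃ g, M • g = j • y + intLin f b) :
    LinEquivExt N a x b y := by
  intro k e hk he
  refine ⟨?_, fun m hm hmN => ?_⟩
  · rcases lt_trichotomy k 0 with hk0 | rfl | hk0
    · obtain ⟨n, rfl⟩ : ∃ n : ℕ, k = -n := ⟨k.natAbs, by omega⟩
      have hn : 0 < n := by omega
      have hnN : n ≤ N := by simpa using hk
      obtain ⟨r, hr⟩ := hNM n hn hnN
      have hr0 : 0 < r := Nat.pos_of_ne_zero (by rintro rfl; omega)
      have key : ∀ (c : ι → G) (z : G), 0 < (-n : ℤ) • z + intLin e c ↔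
          M • z < intLin ((r : ℤ) • e) c := by
        intro c z
        rw [← nsmul_pos_iff_pos hr0, intLin_smul, natCast_zsmul, hr]
        have : r • ((-n : ℤ) • z + intLin e c) = r • intLin e c - (n * r) • z := by
          rw [neg_smul, natCast_zsmul, mul_comm n r, mul_smul, smul_add, smul_neg]; abel
        rw [this, sub_pos]
      rw [key, key]
      refine hup _ fun i => ?_
      have h1 : (r : ℤ) ≤ M := by
        rw [hr]; exact_mod_cast Nat.le_mul_of_pos_left r hn
      simp only [Pi.smul_apply, smul_eq_mul, abs_mul, Nat.abs_cast]
      exact mul_le_mul h1 (he i) (abs_nonneg _) (by positivity)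
    · simpa using (hab e he).1
    · obtain ⟨n, rfl⟩ : ∃ n : ℕ, k = n := ⟨k.natAbs, by omega⟩
      have hn : 0 < n := by omega
      have hnN : n ≤ N := by simpa using hk
      obtain ⟨r, hr⟩ := hNM n hn hnN
      have hr0 : 0 < r := Nat.pos_of_ne_zero (by rintro rfl; omega)
      have key : ∀ (c : ι → G) (z : G), 0 < (n : ℤ) • z + intLin e c ↔
          intLin ((-r : ℤ) • e) c < M • z := by
        intro c z
        rw [← nsmul_pos_iff_pos hr0, intLin_smul, neg_smul, natCast_zsmul, hr, ← sub_pos (b := -_)]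
        have : r • ((n : ℤ) • z + intLin e c) = (n * r) • z - -(r • intLin e c) := by
          rw [natCast_zsmul, mul_comm n r, mul_smul, smul_add]; abel
        rw [natCast_zsmul] at this
        rw [this, natCast_zsmul]
      rw [key, key]
      refine hlo _ fun i => ?_
      have h1 : (r : ℤ) ≤ M := by
        rw [hr]; exact_mod_cast Nat.le_mul_of_pos_left r hn
      simp only [Pi.smul_apply, smul_eq_mul, abs_mul, abs_neg, Nat.abs_cast]
      exact mul_le_mul h1 (he i) (abs_nonneg _) (by positivity)
  · obtain ⟨r, hr⟩ := hNM m hm hmN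
    have hr0 : 0 < r := Nat.pos_of_ne_zero (by rintro rfl; omega)
    have key : ∀ (c : ι → G) (z : G), (∃ g, m • g = k • z + intLin e c) ↔
        ∃ g, M • g = (r * k : ℤ) • z + intLin ((r : ℤ) • e) c := by
      intro c z
      rw [← exists_nsmul_eq_nsmul_iff hr0, hr, mul_comm m r, intLin_smul, mul_smul, ← smul_add,
        natCast_zsmul]
    rw [key, key]
    exact hdiv _ _

/-- If the tuple `b` satisfies the same order conditions as `a`, then a cut of the linear combinations
of `a` yields a nonempty interval bounded by linear combinations of `b`, possibly shifted by a
fixed positive element `t`. -/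
theorem LinEquiv.exists_cut {N K : ℕ} (hK : 2 * K ≤ N) {a b : ι → G} (hab : LinEquiv N a b)
    {t : G} (ht : 0 < t) {x : G} (hx : ∀ f : ι → ℤ, (∀ i, |f i| ≤ K) → x ≠ intLin f a) :
    ∃ u v : G, u < v ∧
      (∃ f : ι → ℤ, (∀ i, |f i| ≤ K) ∧ (u = intLin f b ∨ u = intLin f b - t)) ∧
      (∃ f : ι → ℤ, (∀ i, |f i| ≤ K) ∧ (v = intLin f b ∨ v = intLin f b + t)) ∧
      (∀ f : ι → ℤ, (∀ i, |f i| ≤ K) → intLin f a < x → intLin f b ≤ u) ∧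
      ∀ f : ι → ℤ, (∀ i, |f i| ≤ K) → x < intLin f a → v ≤ intLin f b := by
  classical
  -- Comparing two combinations means testing the sign of their difference, whose coefficients reach
  -- 2K.
  have hord : ∀ f f' : ι → ℤ, (∀ i, |f i| ≤ K) → (∀ i, |f' i| ≤ K) →
      intLin f a < intLin f' a → intLin f b < intLin f' b := by
    intro f f' hf hf' h
    have key : ∀ c : ι → G, intLin (f' + (-1 : ℤ) • f) c = intLin f' c - intLin f c := by
      intro c
      rw [intLin_add, intLin_smul]; module
    have h1 := (hab (f' + (-1 : ℤ) • f) fun i => by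
      have := abs_add_le (f' i) (-f i)
      rw [abs_neg] at this
      have h2 : (2 * K : ℤ) ≤ N := by exact_mod_cast hK
      simp only [Pi.add_apply, Pi.smul_apply, smul_eq_mul, neg_mul, one_mul]
      linarith [hf i, hf' i]).1
    rw [key, key, sub_pos, sub_pos] at h1
    exact h1.1 h
  let S : Finset (ι → ℤ) := Fintype.piFinset fun _ => Finset.Icc (-(K : ℤ)) K
  have hS : ∀ f, f ∈ S ↔ ∀ i, |f i| ≤ K := by
    intro f
    simp [S, abs_le]
  -- The endpoints are the largest combination of b from the lower side and the least from the upper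
  -- side. If one side is empty, its endpoint is the other one shifted by t.
  rcases (S.filter fun f => intLin f a < x).eq_empty_or_nonempty with hL | hL <;>
    rcases (S.filter fun f => x < intLin f a).eq_empty_or_nonempty with hU | hU
  -- The zero combination is in the box and differs from x, so one of the sides contains it.
  · exfalso
    have h0 : (0 : ι → ℤ) ∈ S := (hS 0).2 (by simp)
    rcases lt_or_gt_of_ne (hx 0 (by simp)) with h | h
    · exact absurd hU (Finset.ne_empty_of_mem (Finset.mem_filter.2 ⟨h0, h⟩))
    · exact absurd hL (Finset.ne_empty_of_mem (Finset.mem_filter.2 ⟨h0, h⟩))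
  · obtain ⟨f, hf, hmin⟩ := Finset.exists_min_image _ (fun f => intLin f b) hU
    rw [Finset.mem_filter, hS] at hf
    refine ⟨intLin f b - t, intLin f b, by simpa using ht, ⟨f, hf.1, Or.inr rfl⟩,
      ⟨f, hf.1, Or.inl rfl⟩, fun f' h1 h2 => ?_, fun f' h1 h2 => ?_⟩
    · exact absurd hL (Finset.ne_empty_of_mem (Finset.mem_filter.2 ⟨(hS f').2 h1, h2⟩))
    · exact hmin f' (Finset.mem_filter.2 ⟨(hS f').2 h1, h2⟩)
  · obtain ⟨f, hf, hmax⟩ := Finset.exists_max_image _ (fun f => intLin f b) hL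
    rw [Finset.mem_filter, hS] at hf
    refine ⟨intLin f b, intLin f b + t, by simpa using ht, ⟨f, hf.1, Or.inl rfl⟩,
      ⟨f, hf.1, Or.inr rfl⟩, fun f' h1 h2 => ?_, fun f' h1 h2 => ?_⟩
    · exact hmax f' (Finset.mem_filter.2 ⟨(hS f').2 h1, h2⟩)
    · exact absurd hU (Finset.ne_empty_of_mem (Finset.mem_filter.2 ⟨(hS f').2 h1, h2⟩))
  · obtain ⟨f, hf, hmax⟩ := Finset.exists_max_image _ (fun f => intLin f b) hL
    obtain ⟨f₁, hf₁, hmin⟩ := Finset.exists_min_image _ (fun f => intLin f b) hU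
    rw [Finset.mem_filter, hS] at hf hf₁
    exact ⟨intLin f b, intLin f₁ b, hord _ _ hf.1 hf₁.1 (hf.2.trans hf₁.2), ⟨f, hf.1, Or.inl rfl⟩,
      ⟨f₁, hf₁.1, Or.inl rfl⟩, fun f' h1 h2 => hmax f' (Finset.mem_filter.2 ⟨(hS f').2 h1, h2⟩),
      fun f' h1 h2 => hmin f' (Finset.mem_filter.2 ⟨(hS f').2 h1, h2⟩)⟩

/-- The forth step of the back-and-forth argument, with control on the element found: it may be
taken from any set `Y` that contains the roots of the linear combinations of `b` and that is dense
in the relevant cosets. -/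
theorem LinEquiv.exists_ext {N M : ℕ} (hN : 0 < N) (hM : 0 < M)
    (hNM : ∀ m, 0 < m → m ≤ N → m ∣ M) {a b : ι → G} (hab : LinEquiv (2 * M * N ^ 2) a b)
    {q t : G} (hq : IsGeneric b q) (ht : 0 < t) (Y : Set G)
    (hroot : ∀ (f : ι → ℤ) (y : G), (∀ i, |f i| ≤ (M * N : ℕ)) → M • y = intLin f b → y ∈ Y)
    (hdense : ∀ (j r : ℕ) (h : G) (f f₁ f₂ : ι → ℤ) (u v : G), j * r = M →
      (∀ i, 0 ≤ f i ∧ f i < M) → j • h = intLin f b →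
      (∀ i, |f₁ i| ≤ (M * N : ℕ)) → (u = intLin f₁ b ∨ u = intLin f₁ b - t) →
      (∀ i, |f₂ i| ≤ (M * N : ℕ)) → (v = intLin f₂ b ∨ v = intLin f₂ b + t) → u < v →
      ∃ z, h + r • q + M • z ∈ Y ∧ u < M • (h + r • q + M • z) ∧ M • (h + r • q + M • z) < v)
    (x : G) : ∃ y ∈ Y, LinEquivExt N a x b y := by
  have hNN : N ≤ N ^ 2 := Nat.le_self_pow (by norm_num) N
  have hMN : M * N ≤ M * N ^ 2 := Nat.mul_le_mul_left M hNN
  have hMN' : M ≤ M * N := Nat.le_mul_of_pos_right M hN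
  have hMN'' : N ≤ M * N := Nat.le_mul_of_pos_left N hM
  have h2 : 2 * M * N ^ 2 = 2 * (M * N ^ 2) := by ring
  by_cases hx : ∃ f : ι → ℤ, (∀ i, |f i| ≤ (M * N : ℕ)) ∧ M • x = intLin f a
  · obtain ⟨f, hf, hfx⟩ := hx
    obtain ⟨y, hy⟩ := (hab.divisible_iff hM (by omega) f).1 ⟨x, hfx⟩
    exact ⟨y, hroot f y hf hy, hab.ext_of_nsmul_eq hM le_rfl (by rw [mul_comm N M]; omega)
      (fun i => by simpa using hf i) hfx hy⟩
  · push Not at hx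
    obtain ⟨u, v, huv, ⟨f₁, hf₁, hu⟩, ⟨f₂, hf₂, hv⟩, hlo, hup⟩ :=
      hab.exists_cut (K := M * N) (by omega) ht hx
    obtain ⟨j, r, f, hjr, hf, hdiv, hiff⟩ := exists_divisibility_data hM a x
    have hj : 0 < j := Nat.pos_of_ne_zero (by rintro rfl; omega)
    have hr : 0 < r := Nat.pos_of_ne_zero (by rintro rfl; omega)
    have hjM : j ≤ M := hjr ▸ Nat.le_mul_of_pos_right j hr
    -- Over a, intLin f is divisible by j. Since j ≤ M is within the level, the same holds over b.
    obtain ⟨h, hh⟩ := (hab.divisible_iff hj (by omega) f).1 hdiv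
    obtain ⟨z, hzY, huz, hzv⟩ := hdense j r h f f₁ f₂ u v hjr hf hh hf₁ hu hf₂ hv huv
    refine ⟨_, hzY, (hab.mono (by omega)).ext_of_cut hM hNM (fun f' hf' => ?_) (fun f' hf' => ?_)
      fun k e => ?_⟩
    · have hf'' : ∀ i, |f' i| ≤ (M * N : ℕ) := fun i => by simpa using hf' i
      refine ⟨fun h => (hlo f' hf'' h).trans_lt huz, fun h => ?_⟩
      by_contra hc
      exact absurd ((hup f' hf'' (lt_of_le_of_ne (not_lt.1 hc) (hx f' hf''))).trans_lt h)
        (not_lt.2 hzv.le)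
    · have hf'' : ∀ i, |f' i| ≤ (M * N : ℕ) := fun i => by simpa using hf' i
      refine ⟨fun h => hzv.trans_le (hup f' hf'' h), fun h => ?_⟩
      by_contra hc
      exact absurd (h.trans_le (hlo f' hf'' (lt_of_le_of_ne (not_lt.1 hc) (hx f' hf'').symm)))
        (not_lt.2 huz.le)
    · rw [hiff, hq.divisible_iff hM hjr hh]
      refine exists_congr fun s => and_congr_right fun _ => hab.divisible_iff hM (by omega) _

end OrderedGroup

/-! ### The ordered group of positive rationals -/

/-- The multiplicative group of positive rationals, written additively. -/
abbrev PosRat : Type := Additive {q : ℚ // 0 < q}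

namespace PosRat

/-- The underlying rational number. -/
def val (g : PosRat) : ℚ := (Additive.toMul g).1

/-- A positive rational number as an element of `PosRat`. -/
def mk (q : ℚ) (hq : 0 < q) : PosRat := Additive.ofMul ⟨q, hq⟩

@[simp] theorem val_mk (q : ℚ) (hq : 0 < q) : (mk q hq).val = q := rfl

theorem val_pos (g : PosRat) : 0 < g.val := (Additive.toMul g).2

theorem val_injective : Function.Injective val := fun _ _ h =>
  Additive.toMul.injective (Subtype.ext h)

@[simp] theorem val_zero : val 0 = 1 := rfl

@[simp] theorem val_add (g h : PosRat) : (g + h).val = g.val * h.val := rfl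

@[simp] theorem val_neg (g : PosRat) : (-g).val = g.val⁻¹ := rfl

@[simp] theorem val_nsmul (n : ℕ) (g : PosRat) : (n • g).val = g.val ^ n := rfl

theorem lt_iff (g h : PosRat) : g < h ↔ g.val < h.val := Iff.rfl

/-- The height of a positive rational. -/
def height (g : PosRat) : ℕ := max g.val.num.natAbs g.val.den

theorem one_le_height (g : PosRat) : 1 ≤ g.height :=
  le_max_of_le_right g.val.den_pos

/-- The reduced numerator and denominator divide those of any other fraction for the same number. -/
theorem height_le_of_eq_div {g : PosRat} {p q B : ℕ} (hq : 0 < q) (h : g.val = p / q) (hp : p ≤ B)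
    (hqB : q ≤ B) : g.height ≤ B := by
  have hg := g.val_pos
  have hp0 : 0 < p := by
    rcases Nat.eq_zero_or_pos p with rfl | h'
    · simp [h] at hg
    · exact h'
  have h' : g.val = ((p : ℤ) : ℚ) / ((q : ℤ) : ℚ) := by simpa using h
  have h1 : g.val.num ∣ p := by
    rw [h', ← Rat.divInt_eq_div]; exact Rat.num_dvd _ (by exact_mod_cast hq.ne')
  have h2 : (g.val.den : ℤ) ∣ q := by rw [h', ← Rat.divInt_eq_div]; exact Rat.den_dvd _ _
  have h3 : g.val.num.natAbs ≤ p :=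
    Nat.le_of_dvd hp0 (by simpa using Int.natAbs_dvd_natAbs.2 h1)
  have h4 : g.val.den ≤ q := Nat.le_of_dvd hq (by exact_mod_cast h2)
  exact max_le (h3.trans hp) (h4.trans hqB)

theorem val_eq_div (g : PosRat) : g.val = (g.val.num.natAbs : ℚ) / g.val.den := by
  conv_lhs => rw [← Rat.num_div_den g.val]
  congr 1
  have : 0 < g.val.num := Rat.num_pos.2 g.val_pos
  rw [← Int.cast_natCast, Int.natAbs_of_nonneg this.le]

theorem height_zero : height 0 = 1 := by simp [height]

theorem height_add_le (g h : PosRat) : (g + h).height ≤ g.height * h.height := by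
  refine height_le_of_eq_div (Nat.mul_pos g.val.den_pos h.val.den_pos) (?_ : _ =
    ((g.val.num.natAbs * h.val.num.natAbs : ℕ) : ℚ) / _)
    (Nat.mul_le_mul (le_max_left _ _) (le_max_left _ _))
    (Nat.mul_le_mul (le_max_right _ _) (le_max_right _ _))
  rw [val_add, val_eq_div g, val_eq_div h]
  push_cast
  rw [div_mul_div_comm, ← val_eq_div, ← val_eq_div]

theorem height_neg (g : PosRat) : (-g).height = g.height := by
  have h : ∀ g : PosRat, (-g).height ≤ g.height := fun g => by
    refine height_le_of_eq_div (Int.natAbs_pos.2 (Rat.num_pos.2 g.val_pos).ne') (?_ : _ =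
      (g.val.den : ℚ) / _) (le_max_right _ _) (le_max_left _ _)
    rw [val_neg]
    conv_lhs => rw [val_eq_div g]
    rw [inv_div]
  exact le_antisymm (h g) (by simpa using h (-g))

theorem height_nsmul (n : ℕ) (g : PosRat) : (n • g).height = g.height ^ n := by
  rw [height, val_nsmul, Rat.num_pow, Rat.den_pow, Int.natAbs_pow, height]
  rcases le_total g.val.num.natAbs g.val.den with h | h
  · rw [max_eq_right h, max_eq_right (Nat.pow_le_pow_left h n)]
  · rw [max_eq_left h, max_eq_left (Nat.pow_le_pow_left h n)]

theorem height_le_height_nsmul {n : ℕ} (hn : 0 < n) (g : PosRat) : g.height ≤ (n • g).height := by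
  rw [height_nsmul]
  exact Nat.le_self_pow hn.ne' _

theorem height_zsmul (k : ℤ) (g : PosRat) : (k • g).height = g.height ^ k.natAbs := by
  rcases Int.natAbs_eq k with h | h
  · rw [h, natCast_zsmul, height_nsmul, Int.natAbs_natCast]
  · rw [h, neg_smul, height_neg, natCast_zsmul, height_nsmul, Int.natAbs_neg, Int.natAbs_natCast]

/-- The height is submultiplicative and invariant under inversion, so each of the n terms
contributes a factor of at most A ^ K. -/
theorem height_intLin_le {n A K : ℕ} (hA : 1 ≤ A) {b : Fin n → PosRat}
    (hb : ∀ i, (b i).height ≤ A) {f : Fin n → ℤ} (hf : ∀ i, |f i| ≤ K) :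
    (intLin f b).height ≤ A ^ (n * K) := by
  have h : ∀ s : Finset (Fin n), (∑ i ∈ s, f i • b i).height ≤ A ^ (s.card * K) := by
    intro s
    induction s using Finset.induction_on with
    | empty => simp [height_zero]
    | insert i s hi ih =>
      rw [Finset.sum_insert hi, Finset.card_insert_of_notMem hi, add_mul, one_mul, pow_add,
        mul_comm (A ^ _)]
      refine (height_add_le _ _).trans (Nat.mul_le_mul ?_ ih)
      rw [height_zsmul]
      have : (f i).natAbs ≤ K := by
        have := hf i
        rw [Int.abs_eq_natAbs] at this
        exact_mod_cast this
      exact (Nat.pow_le_pow_left (hb i) _).trans (Nat.pow_le_pow_right hA this)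
  simpa [intLin] using h Finset.univ

/-- The `p`-adic valuation on the positive rationals. -/
def valuation (p : ℕ) [Fact p.Prime] : PosRat →+ ℤ where
  toFun g := padicValRat p g.val
  map_zero' := by simp
  map_add' g h := by rw [val_add, padicValRat.mul g.val_pos.ne' h.val_pos.ne']

theorem valuation_eq_zero {p : ℕ} [Fact p.Prime] {g : PosRat} (h : g.height < p) :
    valuation p g = 0 := by
  have h1 : g.val.num.natAbs < p := (le_max_left _ _).trans_lt h
  have h2 : g.val.den < p := (le_max_right _ _).trans_lt h
  change padicValRat p g.val = 0
  rw [padicValRat, padicValInt,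
    padicValNat.eq_zero_of_not_dvd (Nat.not_dvd_of_pos_of_lt
      (Int.natAbs_pos.2 (Rat.num_pos.2 g.val_pos).ne') h1),
    padicValNat.eq_zero_of_not_dvd (Nat.not_dvd_of_pos_of_lt g.val.den_pos h2)]
  rfl

/-- As in Euclid's argument, a prime factor p of A! + 1 exceeds A. The p-adic valuation then
vanishes on every b i and is 1 at p, so it turns m•g = j•p + intLin f b into m * v(g) = j. -/
theorem exists_isGeneric {n A : ℕ} {b : Fin n → PosRat} (hb : ∀ i, (b i).height ≤ A) :
    ∃ q : PosRat, IsGeneric b q ∧ q.height ≤ A.factorial + 1 := by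
  let p := (A.factorial + 1).minFac
  have hp : p.Prime := Nat.minFac_prime (by have := A.factorial_pos; omega)
  have : Fact p.Prime := ⟨hp⟩
  have hAp : A < p := by
    by_contra h
    have h1 : p ∣ A.factorial := hp.dvd_factorial.2 (not_lt.1 h)
    exact hp.one_lt.ne' (Nat.dvd_one.1 ((Nat.dvd_add_right h1).1 (Nat.minFac_dvd _)))
  refine ⟨mk p (by exact_mod_cast hp.pos), ?_, ?_⟩
  · intro m j f g h
    have h1 := congrArg (valuation p) h
    have h2 : valuation p (mk p (by exact_mod_cast hp.pos)) = 1 := padicValRat.self hp.one_lt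
    have h3 : valuation p (intLin f b) = 0 := by
      rw [intLin, map_sum]
      refine Finset.sum_eq_zero fun i _ => ?_
      rw [map_zsmul, valuation_eq_zero ((hb i).trans_lt hAp), smul_zero]
    rw [map_nsmul, map_add, map_zsmul, h2, h3] at h1
    exact ⟨valuation p g, by simpa using h1.symm⟩
  · exact height_le_of_eq_div one_pos (p := p) (by simp) (Nat.minFac_le (Nat.succ_pos _))
      (by omega)

/-- Bound for the height of an element whose `K`-th multiple lies in a given interval with
endpoints of height at most `H`. -/
def denseBound (K H : ℕ) : ℕ := H * (H * (K * (H ^ 2 + 1))) + 1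

/-- The element is p / D with p least such that its K-th power exceeds u. Passing from p - 1 to p
multiplies the K-th power by less than (H² + 1) / H², by Bernoulli and p > K(H² + 1). The ratio v /
u is at least (H² + 1) / H², because u < v have height at most H. So the K-th power of p / D does
not reach v. -/
theorem exists_nsmul_between {K H : ℕ} (hK : 0 < K) {u v : PosRat} (hu : u.height ≤ H)
    (hv : v.height ≤ H) (huv : u < v) :
    ∃ z : PosRat, u < K • z ∧ K • z < v ∧ z.height ≤ denseBound K H := by
  have hH : 1 ≤ H := u.one_le_height.trans hu
  set T := K * (H ^ 2 + 1) with hT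
  have hT0 : 0 < T := by positivity
  set D := H * T with hD
  have hD0 : 0 < D := by positivity
  have hHq : (1 : ℚ) ≤ H := by exact_mod_cast hH
  have hDq : (0 : ℚ) < D := by exact_mod_cast hD0
  have hu1 : (u.val.num.natAbs : ℚ) ≤ H := by exact_mod_cast (le_max_left _ _).trans hu
  have hu2 : (u.val.den : ℚ) ≤ H := by exact_mod_cast (le_max_right _ _).trans hu
  have hv1 : (v.val.num.natAbs : ℚ) ≤ H := by exact_mod_cast (le_max_left _ _).trans hv
  have hv2 : (v.val.den : ℚ) ≤ H := by exact_mod_cast (le_max_right _ _).trans hv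
  have hu2' : (1 : ℚ) ≤ u.val.den := by exact_mod_cast u.val.den_pos
  have hv2' : (1 : ℚ) ≤ v.val.den := by exact_mod_cast v.val.den_pos
  have hu1' : (1 : ℚ) ≤ u.val.num.natAbs := by
    exact_mod_cast Int.natAbs_pos.2 (Rat.num_pos.2 u.val_pos).ne'
  have huH : u.val ≤ H := by
    rw [val_eq_div u, div_le_iff₀ (by positivity)]
    nlinarith
  have huH' : 1 / (H : ℚ) ≤ u.val := by
    rw [val_eq_div u, div_le_div_iff₀ (by positivity) (by positivity)]
    nlinarith
  have hgap : u.val * ((H : ℚ) ^ 2 + 1) ≤ v.val * H ^ 2 := by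
    rw [lt_iff] at huv
    rw [val_eq_div u, val_eq_div v] at huv ⊢
    rw [div_lt_div_iff₀ (by positivity) (by positivity)] at huv
    have huv' : (u.val.num.natAbs : ℚ) * v.val.den + 1 ≤ v.val.num.natAbs * u.val.den := by
      exact_mod_cast huv
    rw [div_mul_eq_mul_div, div_mul_eq_mul_div, div_le_div_iff₀ (by positivity) (by positivity)]
    have h1 : (u.val.num.natAbs : ℚ) * v.val.den ≤ H ^ 2 := by
      rw [sq]; exact mul_le_mul hu1 hv2 (by positivity) (by positivity)
    nlinarith [mul_le_mul_of_nonneg_right huv' (sq_nonneg (H : ℚ))]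
  -- The size bound is part of the predicate so that the minimum found below inherits it.
  have hex : ∃ p : ℕ, u.val < ((p : ℚ) / D) ^ K ∧ p ≤ H * D + 1 := by
    refine ⟨H * D + 1, huH.trans_lt ?_, le_rfl⟩
    have h1 : (H : ℚ) < ((H * D + 1 : ℕ) : ℚ) / D := by
      rw [lt_div_iff₀ hDq]; push_cast; linarith
    exact h1.trans_le (le_self_pow₀ (hHq.trans h1.le) hK.ne')
  classical
  set p := Nat.find hex with hp
  obtain ⟨hp1, hp2⟩ := Nat.find_spec hex
  rw [← hp] at hp1 hp2
  -- Here the factor H of D is used: p ≤ T would give p / D ≤ 1 / H, whose K-th power is at most 1 /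
  -- H ≤ u.
  have hTp : T < p := by
    by_contra hc
    have h1 : (p : ℚ) / D ≤ 1 / H := by
      rw [div_le_div_iff₀ hDq (by positivity), hD]
      have : (p : ℚ) ≤ T := by exact_mod_cast not_lt.1 hc
      push_cast
      nlinarith
    have h2 : ((p : ℚ) / D) ^ K ≤ 1 / H :=
      (pow_le_pow_left₀ (by positivity) h1 K).trans
        (pow_le_of_le_one (by positivity) (by rw [div_le_one (by positivity)]; exact hHq) hK.ne')
    linarith
  obtain ⟨s, hs⟩ : ∃ s, p = s + 1 := ⟨p - 1, by omega⟩
  have hs1 : ((s : ℚ) / D) ^ K ≤ u.val := by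
    by_contra hc
    exact Nat.find_min hex (m := s) (by omega) ⟨not_le.1 hc, by omega⟩
  have hpq : (0 : ℚ) < p := by exact_mod_cast hT0.trans hTp
  have hbern : (H : ℚ) ^ 2 / (H ^ 2 + 1) < ((s : ℚ) / p) ^ K := by
    have h1 := one_add_mul_le_pow (a := -(1 / (p : ℚ)))
      (by
        have : 1 / (p : ℚ) ≤ 1 := by
          rw [div_le_one hpq]; exact_mod_cast hT0.trans hTp
        linarith) K
    have h2 : 1 + -(1 / (p : ℚ)) = s / p := by
      rw [hs]
      push_cast
      have : (s : ℚ) + 1 ≠ 0 := by positivity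
      field_simp
      ring
    rw [h2] at h1
    refine lt_of_lt_of_le ?_ h1
    have h3 : (K : ℚ) * ((H : ℚ) ^ 2 + 1) < p := by exact_mod_cast hTp
    have h4 : (K : ℚ) / p < 1 / (H ^ 2 + 1) := by
      rw [div_lt_div_iff₀ hpq (by positivity)]; linarith
    have h5 : (H : ℚ) ^ 2 / (H ^ 2 + 1) = 1 - 1 / (H ^ 2 + 1) := by
      field_simp; ring
    have h6 : (K : ℚ) * -(1 / (p : ℚ)) = -(K / p) := by ring
    rw [h5, h6]
    linarith
  have hpv : ((p : ℚ) / D) ^ K < v.val := by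
    have h1 : ((s : ℚ) / D) ^ K = (s / p) ^ K * (p / D) ^ K := by
      rw [← mul_pow]
      congr 1
      field_simp
    have h2 : (H : ℚ) ^ 2 / (H ^ 2 + 1) * (p / D) ^ K < u.val := by
      refine lt_of_lt_of_le ?_ hs1
      rw [h1]
      exact mul_lt_mul_of_pos_right hbern (by positivity)
    rw [div_mul_eq_mul_div, div_lt_iff₀ (by positivity)] at h2
    have h3 : (H : ℚ) ^ 2 * (p / D) ^ K < H ^ 2 * v.val := by linarith
    exact lt_of_mul_lt_mul_left h3 (by positivity)
  refine ⟨mk (p / D) (by positivity), ?_, ?_, ?_⟩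
  · rw [lt_iff]; simpa using hp1
  · rw [lt_iff]; simpa using hpv
  · refine height_le_of_eq_div hD0 rfl hp2 ?_
    have : D ≤ H * D := Nat.le_mul_of_pos_left D hH
    change D ≤ H * D + 1
    omega

end PosRat

open Nat in
/-- The heights of the elements needed in one step of the back-and-forth argument, at level `N` and
over `n` elements of height at most `A`. -/
def witnessBound (N n A : ℕ) : ℕ :=
  A ^ (n * (N ! * N)) +
    A ^ (n * N !) * (A ! + 1) ^ N ! *
      PosRat.denseBound (N ! * N !)
        (2 * A ^ (n * (N ! * N)) * (A ^ (n * N !) * (A ! + 1) ^ N !) ^ N !) ^ N !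

/-- The level needed before one step of the back-and-forth argument that ends at level `N`. -/
def levelStep (N : ℕ) : ℕ := 2 * N.factorial * N ^ 2

/-- This is `LinEquiv.exists_ext` with Y the set of elements of bounded height and t the rational 2.
In the root case the height is at most that of the M-th multiple, which is the first summand of
`witnessBound`. In the cut case z comes from `PosRat.exists_nsmul_between` with exponent M * M,
after subtracting M•(h + r•q) from the endpoints. -/
theorem LinEquiv.exists_ext_posRat {N n A : ℕ} (hN : 0 < N) (hA : 1 ≤ A) {a b : Fin n → PosRat}
    (hab : LinEquiv (levelStep N) a b) (hb : ∀ i, (b i).height ≤ A) (x : PosRat) :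
    ∃ y : PosRat, y.height ≤ witnessBound N n A ∧ LinEquivExt N a x b y := by
  obtain ⟨q, hq, hqA⟩ := PosRat.exists_isGeneric hb
  set M := N.factorial with hMdef
  have hM : 0 < M := N.factorial_pos
  have ht : (0 : PosRat) < PosRat.mk 2 (by norm_num) := by
    rw [PosRat.lt_iff]; simp
  have ht2 : (PosRat.mk 2 (by norm_num)).height ≤ 2 :=
    PosRat.height_le_of_eq_div (p := 2) one_pos (by simp) le_rfl (by norm_num)
  refine hab.exists_ext hN hM (fun m hm hmN => Nat.dvd_factorial hm hmN) hq ht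
    {y | y.height ≤ witnessBound N n A} ?_ ?_ x
  · intro f y hf hy
    refine (PosRat.height_le_height_nsmul hM y).trans ?_
    rw [hy]
    exact (PosRat.height_intLin_le hA hb hf).trans (Nat.le_add_right _ _)
  · intro j r h f f₁ f₂ u v hjr hf hh hf₁ hu hf₂ hv huv
    have hj : 0 < j := Nat.pos_of_ne_zero (by rintro rfl; omega)
    have hr : r ≤ M := hjr ▸ Nat.le_mul_of_pos_left r hj
    have hhA : h.height ≤ A ^ (n * M) := by
      refine (PosRat.height_le_height_nsmul hj h).trans ?_
      rw [hh]
      exact PosRat.height_intLin_le hA hb fun i => by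
        rw [abs_of_nonneg (hf i).1]; exact (hf i).2.le
    have hc : (h + r • q).height ≤ A ^ (n * M) * (A.factorial + 1) ^ M := by
      refine (PosRat.height_add_le _ _).trans (Nat.mul_le_mul hhA ?_)
      rw [PosRat.height_nsmul]
      exact (Nat.pow_le_pow_left hqA r).trans (Nat.pow_le_pow_right (Nat.succ_pos _) hr)
    set C := A ^ (n * M) * (A.factorial + 1) ^ M with hC
    have hu' : u.height ≤ 2 * A ^ (n * (M * N)) := by
      have := PosRat.height_intLin_le hA hb hf₁
      rcases hu with rfl | rfl
      · omega
      · rw [sub_eq_add_neg]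
        refine (PosRat.height_add_le _ _).trans ?_
        rw [PosRat.height_neg, mul_comm]
        exact Nat.mul_le_mul ht2 this
    have hv' : v.height ≤ 2 * A ^ (n * (M * N)) := by
      have := PosRat.height_intLin_le hA hb hf₂
      rcases hv with rfl | rfl
      · omega
      · refine (PosRat.height_add_le _ _).trans ?_
        rw [mul_comm]
        exact Nat.mul_le_mul ht2 this
    have hsub : ∀ w : PosRat, w.height ≤ 2 * A ^ (n * (M * N)) →
        (w - M • (h + r • q)).height ≤ 2 * A ^ (n * (M * N)) * C ^ M := by
      intro w hw
      rw [sub_eq_add_neg]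
      refine (PosRat.height_add_le _ _).trans (Nat.mul_le_mul hw ?_)
      rw [PosRat.height_neg, PosRat.height_nsmul]
      exact Nat.pow_le_pow_left hc M
    obtain ⟨z, hz1, hz2, hz3⟩ := PosRat.exists_nsmul_between (Nat.mul_pos hM hM) (hsub u hu')
      (hsub v hv') (sub_lt_sub_right huv _)
    have hexp : M • (h + r • q + M • z) = (M * M) • z + M • (h + r • q) := by
      rw [nsmul_add, mul_nsmul, add_comm]
    refine ⟨z, ?_, ?_, ?_⟩
    · refine (PosRat.height_add_le _ _).trans (le_trans (Nat.mul_le_mul hc ?_)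
        (Nat.le_add_left _ _))
      rw [PosRat.height_nsmul]
      exact Nat.pow_le_pow_left hz3 M
    · rw [hexp]; exact sub_lt_iff_lt_add.1 hz1
    · rw [hexp]; exact lt_sub_iff_add_lt.1 hz2

/-! ### Tuples of rationals -/

/-- The absolute value of a rational as an element of the group of positive rationals; the value at
`0` is irrelevant. -/
noncomputable def ratMag (x : ℚ) : PosRat :=
  if h : x = 0 then 0 else PosRat.mk |x| (abs_pos.2 h)

theorem ratMag_zero : ratMag 0 = 0 := by simp [ratMag]

theorem val_ratMag {x : ℚ} (hx : x ≠ 0) : (ratMag x).val = |x| := by simp [ratMag, hx]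

theorem ratMag_one : ratMag 1 = 0 := PosRat.val_injective (by simp [val_ratMag])

theorem ratMag_mul {x y : ℚ} (hx : x ≠ 0) (hy : y ≠ 0) : ratMag (x * y) = ratMag x + ratMag y :=
  PosRat.val_injective (by simp [val_ratMag, hx, hy, abs_mul])

theorem ratMag_inv (x : ℚ) : ratMag x⁻¹ = -ratMag x := by
  by_cases hx : x = 0
  · simp [hx, ratMag_zero]
  · exact PosRat.val_injective (by simp [val_ratMag, hx, abs_inv])

/-- Together with `exists_eq_pow_iff_ratMag`, this separates the relations of the two languages into
a condition on signs and a condition in the ordered group. -/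
theorem lt_iff_sign_ratMag (x y : ℚ) : x < y ↔ SignType.sign x < SignType.sign y ∨
    (SignType.sign x = 1 ∧ SignType.sign y = 1 ∧ ratMag x < ratMag y) ∨
    (SignType.sign x = -1 ∧ SignType.sign y = -1 ∧ ratMag y < ratMag x) := by
  rcases lt_trichotomy x 0 with hx | rfl | hx <;> rcases lt_trichotomy y 0 with hy | rfl | hy
  · simp [sign_neg hx, sign_neg hy, PosRat.lt_iff, val_ratMag hx.ne, val_ratMag hy.ne,
      abs_of_neg hx, abs_of_neg hy]
  · simp [sign_neg hx, hx]
  · simp [sign_neg hx, sign_pos hy, hx.trans hy]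
  · simp [sign_neg hy, hy.le]
  · simp
  · simp [sign_pos hy, hy]
  · simp [sign_neg hy, sign_pos hx, (hy.trans hx).le]
  · simp [sign_pos hx, hx.le]
  · simp [sign_pos hx, sign_pos hy, PosRat.lt_iff, val_ratMag hx.ne', val_ratMag hy.ne',
      abs_of_pos hx, abs_of_pos hy]

theorem exists_eq_pow_iff_ratMag {n : ℕ} (hn : n ≠ 0) (x : ℚ) : (∃ y : ℚ, x = y ^ n) ↔
    SignType.sign x = 0 ∨
      ((SignType.sign x = 1 ∨ Odd n) ∧ SignType.sign x ≠ 0 ∧ ∃ g, n • g = ratMag x) := by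
  rw [sign_eq_zero_iff, sign_eq_one_iff, Ne, sign_eq_zero_iff]
  by_cases hx : x = 0
  · simp only [hx, true_or, iff_true]
    exact ⟨0, by simp [hn]⟩
  simp only [hx, false_or, not_false_eq_true, true_and]
  constructor
  · rintro ⟨y, rfl⟩
    have hy : y ≠ 0 := fun h => hx (by simp [h, hn])
    refine ⟨?_, ratMag y, PosRat.val_injective ?_⟩
    · rcases Nat.even_or_odd n with h | h
      · exact Or.inl (h.pow_pos hy)
      · exact Or.inr h
    · rw [PosRat.val_nsmul, val_ratMag hx, val_ratMag hy, abs_pow]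
  · rintro ⟨h, g, hg⟩
    have hg' : g.val ^ n = |x| := by rw [← PosRat.val_nsmul, hg, val_ratMag hx]
    rcases lt_or_gt_of_ne hx with hx' | hx'
    · rcases h with h | h
      · exact absurd h (not_lt.2 hx'.le)
      · exact ⟨-g.val, by rw [h.neg_pow, hg', abs_of_neg hx', neg_neg]⟩
    · exact ⟨g.val, by rw [hg', abs_of_pos hx']⟩

/-- Two tuples of rationals satisfy the same conditions of complexity at most `N`. -/
def RatEquiv {n : ℕ} (N : ℕ) (a b : Fin n → ℚ) : Prop :=
  (∀ i, SignType.sign (a i) = SignType.sign (b i)) ∧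
    LinEquiv N (fun i => ratMag (a i)) (fun i => ratMag (b i))

theorem RatEquiv.mono {n N N' : ℕ} (h : N ≤ N') {a b : Fin n → ℚ} (hab : RatEquiv N' a b) :
    RatEquiv N a b := ⟨hab.1, hab.2.mono h⟩

theorem RatEquiv.symm {n N : ℕ} {a b : Fin n → ℚ} (hab : RatEquiv N a b) : RatEquiv N b a :=
  ⟨fun i => (hab.1 i).symm, fun e he => ⟨(hab.2 e he).1.symm, fun m h1 h2 =>
    ((hab.2 e he).2 m h1 h2).symm⟩⟩

theorem RatEquiv.refl {n : ℕ} (N : ℕ) (a : Fin n → ℚ) : RatEquiv N a a :=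
  ⟨fun _ => rfl, fun _ _ => ⟨Iff.rfl, fun _ _ _ => Iff.rfl⟩⟩

theorem ratEquiv_snoc {n N : ℕ} {a b : Fin n → ℚ} (hab : ∀ i, SignType.sign (a i) = SignType.sign (b i))
    {x y : ℚ} (hxy : SignType.sign x = SignType.sign y)
    (h : LinEquivExt N (fun i => ratMag (a i)) (ratMag x) (fun i => ratMag (b i)) (ratMag y)) :
    RatEquiv N (Fin.snoc a x : Fin (n + 1) → ℚ) (Fin.snoc b y : Fin (n + 1) → ℚ) := by
  have key : ∀ (e : Fin (n + 1) → ℤ) (c : Fin n → ℚ) (z : ℚ),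
      intLin e (fun i => ratMag ((Fin.snoc c z : Fin (n + 1) → ℚ) i)) =
        e (Fin.last n) • ratMag z + intLin (fun i => e i.castSucc) (fun i => ratMag (c i)) := by
    intro e c z
    rw [intLin, Fin.sum_univ_castSucc]
    simp [intLin, add_comm]
  refine ⟨fun i => ?_, fun e he => ?_⟩
  · refine Fin.lastCases ?_ (fun i => ?_) i
    · simpa using hxy
    · simpa using hab i
  · rw [key, key]
    exact h _ _ (he _) fun i => he _

/-- The forth step of the back-and-forth argument for tuples of rationals. -/
theorem RatEquiv.exists_snoc {N n A : ℕ} (hN : 0 < N) (hA : 1 ≤ A) {a b : Fin n → ℚ}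
    (hab : RatEquiv (levelStep N) a b) (hb : ∀ i, (ratMag (b i)).height ≤ A) (x : ℚ) :
    ∃ y : ℚ, (ratMag y).height ≤ witnessBound N n A ∧
      RatEquiv N (Fin.snoc a x : Fin (n + 1) → ℚ) (Fin.snoc b y : Fin (n + 1) → ℚ) := by
  -- Zero is matched with zero. Its magnitude is by convention the neutral element, so the
  -- conditions on the extended tuples reduce to those on a and b.
  by_cases hx : x = 0
  · subst hx
    have hle : N ≤ levelStep N := by
      have h1 : N ≤ N ^ 2 := Nat.le_self_pow (by norm_num) N
      have h2 : N ^ 2 ≤ 2 * N.factorial * N ^ 2 :=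
        Nat.le_mul_of_pos_left _ (Nat.mul_pos two_pos N.factorial_pos)
      exact h1.trans h2
    refine ⟨0, ?_, ratEquiv_snoc hab.1 rfl fun k e _ he => ?_⟩
    · rw [ratMag_zero, PosRat.height_zero]
      exact (Nat.one_le_pow _ _ hA).trans (Nat.le_add_right _ _)
    · rw [ratMag_zero, zsmul_zero, zero_add, zero_add]
      exact (hab.mono hle).2 e he
  · obtain ⟨y, hy, hext⟩ := hab.2.exists_ext_posRat hN hA hb (ratMag x)
    have hyv := y.val_pos
    obtain ⟨z, hz, hsign⟩ : ∃ z : ℚ, ratMag z = y ∧ SignType.sign x = SignType.sign z := by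
      rcases lt_or_gt_of_ne hx with h | h
      · refine ⟨-y.val, PosRat.val_injective ?_, ?_⟩
        · rw [val_ratMag (by simpa using hyv.ne'), abs_neg, abs_of_pos hyv]
        · rw [sign_neg h, sign_neg (by simpa using hyv)]
      · refine ⟨y.val, PosRat.val_injective ?_, ?_⟩
        · rw [val_ratMag hyv.ne', abs_of_pos hyv]
        · rw [sign_pos h, sign_pos hyv]
    refine ⟨z, hz ▸ hy, ratEquiv_snoc hab.1 hsign ?_⟩
    rw [hz]
    exact hext

/-! ### Functions that are monomial up to sign -/

/-- The function `τ` is, up to zeros and signs that depend on the signs of the arguments only, a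
monomial with exponents bounded by `c`. -/
def IsMonomial {n : ℕ} (c : ℕ) (τ : (Fin n → ℚ) → ℚ) : Prop :=
  (∀ a b : Fin n → ℚ, (∀ i, SignType.sign (a i) = SignType.sign (b i)) →
    SignType.sign (τ a) = SignType.sign (τ b)) ∧
  ∃ e : Fin n → ℤ, (∀ i, |e i| ≤ c) ∧
    ∀ a, τ a ≠ 0 → ratMag (τ a) = intLin e fun i => ratMag (a i)

namespace IsMonomial

variable {n : ℕ}

theorem mono {c d : ℕ} (h : c ≤ d) {τ : (Fin n → ℚ) → ℚ} (hτ : IsMonomial c τ) :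
    IsMonomial d τ := by
  obtain ⟨h1, e, h2, h3⟩ := hτ
  exact ⟨h1, e, fun i => (h2 i).trans (by exact_mod_cast h), h3⟩

theorem zero : IsMonomial 0 fun _ : Fin n → ℚ => (0 : ℚ) :=
  ⟨fun _ _ _ => rfl, 0, by simp, fun _ h => absurd rfl h⟩

theorem one : IsMonomial 0 fun _ : Fin n → ℚ => (1 : ℚ) :=
  ⟨fun _ _ _ => rfl, 0, by simp, fun _ _ => by rw [ratMag_one, intLin_zero]⟩

theorem var (i : Fin n) : IsMonomial 1 fun a : Fin n → ℚ => a i := by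
  refine ⟨fun _ _ h => h i, Pi.single i 1, fun j => ?_, fun a _ => ?_⟩
  · by_cases h : j = i
    · subst h; simp
    · simp [h]
  · simp [intLin, Pi.single_apply, ite_smul]

theorem mul {c d : ℕ} {τ σ : (Fin n → ℚ) → ℚ} (hτ : IsMonomial c τ) (hσ : IsMonomial d σ) :
    IsMonomial (c + d) fun a => τ a * σ a := by
  obtain ⟨h1, e, h2, h3⟩ := hτ
  obtain ⟨h1', e', h2', h3'⟩ := hσ
  refine ⟨fun a b h => by rw [sign_mul, sign_mul, h1 a b h, h1' a b h], e + e', fun i => ?_,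
    fun a ha => ?_⟩
  · have := abs_add_le (e i) (e' i)
    push_cast
    exact this.trans (add_le_add (h2 i) (h2' i))
  · rw [ratMag_mul (left_ne_zero_of_mul ha) (right_ne_zero_of_mul ha), intLin_add,
      h3 a (left_ne_zero_of_mul ha), h3' a (right_ne_zero_of_mul ha)]

theorem inv {c : ℕ} {τ : (Fin n → ℚ) → ℚ} (hτ : IsMonomial c τ) :
    IsMonomial c fun a => (τ a)⁻¹ := by
  obtain ⟨h1, e, h2, h3⟩ := hτ
  have hsign : ∀ x : ℚ, SignType.sign x⁻¹ = SignType.sign x := by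
    intro x
    rcases lt_trichotomy x 0 with h | rfl | h
    · rw [sign_neg h, sign_neg (inv_lt_zero.2 h)]
    · simp
    · rw [sign_pos h, sign_pos (inv_pos.2 h)]
  refine ⟨fun a b h => by rw [hsign, hsign, h1 a b h], (-1 : ℤ) • e, fun i => ?_, fun a ha => ?_⟩
  · simpa using h2 i
  · rw [ratMag_inv, h3 a (fun h => ha (by simp [h])), intLin_smul, neg_one_zsmul]

variable {N c d : ℕ} {τ σ : (Fin n → ℚ) → ℚ} {a b : Fin n → ℚ}

theorem ratMag_lt_iff (hτ : IsMonomial c τ) (hσ : IsMonomial d σ) (hab : RatEquiv N a b)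
    (hN : c + d ≤ N) (hτa : τ a ≠ 0) (hσa : σ a ≠ 0) (hτb : τ b ≠ 0) (hσb : σ b ≠ 0) :
    ratMag (τ a) < ratMag (σ a) ↔ ratMag (τ b) < ratMag (σ b) := by
  obtain ⟨-, e, h2, h3⟩ := hτ
  obtain ⟨-, e', h2', h3'⟩ := hσ
  have key : ∀ x, τ x ≠ 0 → σ x ≠ 0 → (ratMag (τ x) < ratMag (σ x) ↔
      0 < intLin (e' + (-1 : ℤ) • e) fun i => ratMag (x i)) := by
    intro x h h'
    rw [intLin_add, intLin_smul, neg_one_zsmul, ← sub_eq_add_neg, sub_pos, h3 x h, h3' x h']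
  rw [key a hτa hσa, key b hτb hσb]
  refine (hab.2 _ fun i => ?_).1
  have h4 := abs_add_le (e' i) (-e i)
  rw [abs_neg] at h4
  have h5 : (c : ℤ) + d ≤ N := by exact_mod_cast hN
  simp only [Pi.add_apply, Pi.smul_apply, smul_eq_mul, neg_mul, one_mul]
  linarith [h2 i, h2' i]

theorem lt_iff (hτ : IsMonomial c τ) (hσ : IsMonomial d σ) (hab : RatEquiv N a b)
    (hN : c + d ≤ N) : τ a < σ a ↔ τ b < σ b := by
  have h1 := hτ.1 a b hab.1
  have h2 := hσ.1 a b hab.1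
  rw [lt_iff_sign_ratMag, lt_iff_sign_ratMag (τ b), h1, h2]
  have hne : ∀ {x : ℚ} {s : SignType}, s ≠ 0 → SignType.sign x = s → x ≠ 0 := by
    rintro x s hs rfl rfl
    simp at hs
  refine or_congr Iff.rfl (or_congr ?_ ?_) <;>
    refine and_congr_right fun h3 => and_congr_right fun h4 => ?_
  · exact hτ.ratMag_lt_iff hσ hab hN (hne (by decide) (h1.trans h3)) (hne (by decide) (h2.trans h4))
      (hne (by decide) h3) (hne (by decide) h4)
  · exact hσ.ratMag_lt_iff hτ hab (by omega) (hne (by decide) (h2.trans h4))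
      (hne (by decide) (h1.trans h3)) (hne (by decide) h4) (hne (by decide) h3)

theorem eq_iff (hτ : IsMonomial c τ) (hσ : IsMonomial d σ) (hab : RatEquiv N a b)
    (hN : c + d ≤ N) : τ a = σ a ↔ τ b = σ b := by
  have key : ∀ x y : ℚ, x = y ↔ ¬ x < y ∧ ¬ y < x := fun x y => by
    rw [not_lt, not_lt, le_antisymm_iff, and_comm]
  rw [key, key (τ b), hτ.lt_iff hσ hab hN, hσ.lt_iff hτ hab (by omega)]

theorem isPow_iff (hτ : IsMonomial c τ) (hab : RatEquiv N a b) (hN : c ≤ N) {m : ℕ} (hm : m ≠ 0)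
    (hmN : m ≤ N) : (∃ y : ℚ, τ a = y ^ m) ↔ ∃ y : ℚ, τ b = y ^ m := by
  have h1 := hτ.1 a b hab.1
  obtain ⟨-, e, h2, h3⟩ := hτ
  rw [exists_eq_pow_iff_ratMag hm, exists_eq_pow_iff_ratMag hm, h1]
  refine or_congr Iff.rfl (and_congr_right fun _ => and_congr_right fun h => ?_)
  have hb : τ b ≠ 0 := fun h' => h (by simp [h'])
  have ha : τ a ≠ 0 := fun h' => h (by simp [← h1, h'])
  rw [h3 a ha, h3 b hb]
  exact (hab.2 e fun i => (h2 i).trans (by exact_mod_cast hN)).2 m (Nat.pos_of_ne_zero hm) hmN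

end IsMonomial

/-! ### Invariance of formulas -/

/-- The truth of a formula with Gödel number `c` is decided by the conditions of complexity at most
`level c`. -/
def level (c : ℕ) : ℕ := Nat.rec 1 (fun _ N => levelStep N) c

theorem level_pos_and_lt (c : ℕ) : 0 < level c ∧ level c < level (c + 1) := by
  have key : ∀ N, 0 < N → N < levelStep N := by
    intro N hN
    have h1 : N ≤ N ^ 2 := Nat.le_self_pow (by norm_num) N
    have h2 : 2 * N ^ 2 ≤ 2 * N.factorial * N ^ 2 :=
      Nat.mul_le_mul_right _ (by have := N.factorial_pos; omega)
    rw [levelStep]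
    omega
  induction c with
  | zero => exact ⟨one_pos, key 1 one_pos⟩
  | succ c ih =>
    have h : 0 < level (c + 1) := ih.1.trans ih.2
    exact ⟨h, key _ h⟩

theorem level_strictMono : StrictMono level := strictMono_nat_of_lt_succ fun c => (level_pos_and_lt c).2

theorem succ_le_level (c : ℕ) : c + 1 ≤ level c := by
  induction c with
  | zero => exact (level_pos_and_lt 0).1
  | succ c ih => exact ih.trans_lt (level_pos_and_lt c).2

/-- The truth of the atomic formulas of `L` in the rationals depends on the conditions of bounded
complexity. -/
def AtomicInvariant {L : Language} [L.Structure ℚ] (S : SymbolNumbering L) : Prop :=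
  ∀ (n : ℕ) (φ : L.BoundedFormula Empty n), φ.IsAtomic → ∀ (v : Empty → ℚ) (a b : Fin n → ℚ),
    RatEquiv (formulaCode S φ + 1) a b → (φ.Realize v a ↔ φ.Realize v b)

theorem exists_height_le {n : ℕ} (b : Fin n → ℚ) : ∃ A, 1 ≤ A ∧ ∀ i, (ratMag (b i)).height ≤ A :=
  ⟨1 + ∑ i, (ratMag (b i)).height, by omega, fun i =>
    (Finset.single_le_sum (f := fun i => (ratMag (b i)).height) (fun _ _ => Nat.zero_le _)
      (Finset.mem_univ i)).trans (Nat.le_add_left _ _)⟩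

/-- Induction on φ. A quantifier costs one `levelStep`, which is available because the code of φ.all
exceeds that of φ. The forth step, applied in both directions by symmetry, gives the two
implications. -/
theorem AtomicInvariant.realize_iff {L : Language} [L.Structure ℚ] {S : SymbolNumbering L}
    (hS : AtomicInvariant S) {n : ℕ} (φ : L.BoundedFormula Empty n) (v : Empty → ℚ)
    {a b : Fin n → ℚ} (hab : RatEquiv (level (formulaCode S φ)) a b) :
    φ.Realize v a ↔ φ.Realize v b := by
  induction φ with
  | falsum => exact Iff.rfl
  | equal t₁ t₂ => exact hS _ _ (.equal t₁ t₂) v a b (hab.mono (succ_le_level _))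
  | rel R ts => exact hS _ _ (.rel R ts) v a b (hab.mono (succ_le_level _))
  | imp φ ψ ih1 ih2 =>
    have h : formulaCode S (φ.imp ψ) = Nat.pair 3 (Nat.pair (formulaCode S φ) (formulaCode S ψ)) :=
      rfl
    have h1 : formulaCode S φ ≤ formulaCode S (φ.imp ψ) := by
      rw [h]; exact (Nat.left_le_pair _ _).trans (Nat.right_le_pair _ _)
    have h2 : formulaCode S ψ ≤ formulaCode S (φ.imp ψ) := by
      rw [h]; exact (Nat.right_le_pair _ _).trans (Nat.right_le_pair _ _)
    rw [BoundedFormula.realize_imp, BoundedFormula.realize_imp,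
      ih1 (hab.mono (level_strictMono.monotone h1)), ih2 (hab.mono (level_strictMono.monotone h2))]
  | all φ ih =>
    have h1 : formulaCode S φ + 1 ≤ formulaCode S φ.all := by
      change _ ≤ Nat.pair 4 (formulaCode S φ)
      have := Nat.add_le_pair 4 (formulaCode S φ)
      omega
    have hab' : RatEquiv (levelStep (level (formulaCode S φ))) a b :=
      hab.mono (level_strictMono.monotone h1)
    have key : ∀ {a b}, RatEquiv (levelStep (level (formulaCode S φ))) a b →
        (∀ x, φ.Realize v (Fin.snoc b x)) → ∀ x, φ.Realize v (Fin.snoc a x) := by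
      intro a b hab h x
      obtain ⟨A, hA, hbA⟩ := exists_height_le b
      obtain ⟨y, -, hy⟩ := hab.exists_snoc (level_pos_and_lt _).1 hA hbA x
      exact (ih hy).2 (h y)
    exact ⟨key hab'.symm, key hab'⟩

/-- A universal quantifier over the rationals may be bounded. -/
theorem AtomicInvariant.forall_iff {L : Language} [L.Structure ℚ] {S : SymbolNumbering L}
    (hS : AtomicInvariant S) {n A : ℕ} (φ : L.BoundedFormula Empty (n + 1)) (v : Empty → ℚ)
    {a : Fin n → ℚ} (hA : 1 ≤ A) (ha : ∀ i, (ratMag (a i)).height ≤ A) :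
    (∀ x : ℚ, φ.Realize v (Fin.snoc a x)) ↔
      ∀ x : ℚ, (ratMag x).height ≤ witnessBound (level (formulaCode S φ)) n A →
        φ.Realize v (Fin.snoc a x) := by
  refine ⟨fun h x _ => h x, fun h x => ?_⟩
  -- The forth step from a to itself replaces an arbitrary x by a y of bounded height that the
  -- formula cannot distinguish from x over a.
  obtain ⟨y, hy, hxy⟩ :=
    (RatEquiv.refl (levelStep (level (formulaCode S φ))) a).exists_snoc (level_pos_and_lt _).1 hA ha x
  exact (hS.realize_iff φ v hxy).2 (h y hy)

/-! ### Atomic formulas of the two languages -/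

theorem lt_encode_of_mem {l : List ℕ} {x : ℕ} (h : x ∈ l) : x < Encodable.encode l := by
  induction l with
  | nil => simp at h
  | cons y l ih =>
    rw [Encodable.encode_list_cons, Encodable.encode_nat]
    rcases List.mem_cons.1 h with rfl | h
    · exact Nat.lt_succ_of_le (Nat.left_le_pair _ _)
    · exact (ih h).trans (Nat.lt_succ_of_le (Nat.right_le_pair _ _))

theorem add_add_two_le_encode_pair (x y : ℕ) : x + y + 2 ≤ Encodable.encode [x, y] := by
  rw [Encodable.encode_list_cons, Encodable.encode_list_cons, Encodable.encode_nat,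
    Encodable.encode_nat]
  have h1 := Nat.add_le_pair x (Nat.pair y (Encodable.encode ([] : List ℕ))).succ
  have h2 := Nat.left_le_pair y (Encodable.encode ([] : List ℕ))
  omega

theorem termCode_func_ge {L : Language} (S : SymbolNumbering L) {n k : ℕ} (f : L.Functions k)
    (ts : Fin k → L.Term (Empty ⊕ Fin n)) :
    Encodable.encode (List.ofFn fun i => termCode S (ts i)) + 1 ≤ termCode S (.func f ts) := by
  rw [termCode]
  have h1 := Nat.add_le_pair 1 (Nat.pair (S.func ⟨_, f⟩)
    (Encodable.encode (List.ofFn fun i => termCode S (ts i))))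
  have h2 := Nat.right_le_pair (S.func ⟨_, f⟩)
    (Encodable.encode (List.ofFn fun i => termCode S (ts i)))
  omega

theorem formulaCode_rel_ge {L : Language} (S : SymbolNumbering L) {n k : ℕ} (R : L.Relations k)
    (ts : Fin k → L.Term (Empty ⊕ Fin n)) :
    Encodable.encode (List.ofFn fun i => termCode S (ts i)) ≤
      formulaCode S (.rel R ts : L.BoundedFormula Empty n) ∧
    S.rel ⟨_, R⟩ ≤ formulaCode S (.rel R ts : L.BoundedFormula Empty n) := by
  rw [formulaCode]
  exact ⟨(Nat.right_le_pair _ _).trans (Nat.right_le_pair _ _),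
    (Nat.left_le_pair _ _).trans (Nat.right_le_pair _ _)⟩

/-- Gödel numbers serve as crude bounds for exponents: the code of a product is large enough to
dominate the sum of the bounds of its factors. The summand 1 is needed for the variable x₀, which
has code 0 and exponent 1. -/
theorem isMonomial_powLang {n : ℕ} (t : powLang.Term (Empty ⊕ Fin n)) (v : Empty → ℚ) :
    IsMonomial (termCode powNumbering t + 1) fun a => t.realize (Sum.elim v a) := by
  induction t with
  | var i =>
    rcases i with i | i
    · exact i.elim
    · exact (IsMonomial.var i).mono (Nat.le_add_left _ _)
  | func f ts ih =>
    have hge := termCode_func_ge powNumbering f ts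
    cases f with
    | zero => exact IsMonomial.zero.mono (Nat.zero_le _)
    | one => exact IsMonomial.one.mono (Nat.zero_le _)
    | mul =>
      refine ((ih 0).mul (ih 1)).mono ?_
      have h := add_add_two_le_encode_pair (termCode powNumbering (ts 0))
        (termCode powNumbering (ts 1))
      have h' : (List.ofFn fun i => termCode powNumbering (ts i)) =
        [termCode powNumbering (ts 0), termCode powNumbering (ts 1)] := rfl
      rw [h'] at hge
      omega
    | inv =>
      refine (ih 0).inv.mono ?_
      have h : termCode powNumbering (ts 0) <
          Encodable.encode (List.ofFn fun i => termCode powNumbering (ts i)) :=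
        lt_encode_of_mem (List.mem_ofFn.2 ⟨0, rfl⟩)
      omega

theorem isMonomial_mulOrdLang {n : ℕ} (t : mulOrdLang.Term (Empty ⊕ Fin n)) (v : Empty → ℚ) :
    IsMonomial (termCode mulOrdNumbering t + 1) fun a => t.realize (Sum.elim v a) := by
  induction t with
  | var i =>
    rcases i with i | i
    · exact i.elim
    · exact (IsMonomial.var i).mono (Nat.le_add_left _ _)
  | func f ts ih =>
    have hge := termCode_func_ge mulOrdNumbering f ts
    cases f with
    | mul =>
      refine ((ih 0).mul (ih 1)).mono ?_
      have h := add_add_two_le_encode_pair (termCode mulOrdNumbering (ts 0))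
        (termCode mulOrdNumbering (ts 1))
      have h' : (List.ofFn fun i => termCode mulOrdNumbering (ts i)) =
        [termCode mulOrdNumbering (ts 0), termCode mulOrdNumbering (ts 1)] := rfl
      rw [h'] at hge
      omega

theorem add_le_formulaCode_equal {L : Language} (S : SymbolNumbering L) {n : ℕ}
    (t₁ t₂ : L.Term (Empty ⊕ Fin n)) :
    (termCode S t₁ + 1) + (termCode S t₂ + 1) ≤
      formulaCode S (.equal t₁ t₂ : L.BoundedFormula Empty n) + 1 := by
  rw [formulaCode]
  have h1 := Nat.add_le_pair (termCode S t₁) (termCode S t₂)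
  have h2 := Nat.add_le_pair 1 (Nat.pair (termCode S t₁) (termCode S t₂))
  omega

theorem atomicInvariant_powNumbering : AtomicInvariant powNumbering := by
  intro n φ hφ v a b hab
  cases hφ with
  | equal t₁ t₂ =>
    exact (isMonomial_powLang t₁ v).eq_iff (isMonomial_powLang t₂ v) hab
      (add_le_formulaCode_equal powNumbering t₁ t₂)
  | rel R ts =>
    obtain ⟨h1, h2⟩ := formulaCode_rel_ge powNumbering R ts
    cases R with
    | lt =>
      refine (isMonomial_powLang (ts 0) v).lt_iff (isMonomial_powLang (ts 1) v) hab ?_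
      have h := add_add_two_le_encode_pair (termCode powNumbering (ts 0))
        (termCode powNumbering (ts 1))
      have h' : (List.ofFn fun i => termCode powNumbering (ts i)) =
        [termCode powNumbering (ts 0), termCode powNumbering (ts 1)] := rfl
      rw [h'] at h1
      exact (by omega : _ ≤ _).trans (h1.trans (Nat.le_succ _))
    | isPow m hm =>
      have h : termCode powNumbering (ts 0) <
          Encodable.encode (List.ofFn fun i => termCode powNumbering (ts i)) :=
        lt_encode_of_mem (List.mem_ofFn.2 ⟨0, rfl⟩)
      exact (isMonomial_powLang (ts 0) v).isPow_iff hab (Nat.succ_le_succ (h.le.trans h1))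
        (by omega) (Nat.le_succ_of_le h2)

theorem atomicInvariant_mulOrdNumbering : AtomicInvariant mulOrdNumbering := by
  intro n φ hφ v a b hab
  cases hφ with
  | equal t₁ t₂ =>
    exact (isMonomial_mulOrdLang t₁ v).eq_iff (isMonomial_mulOrdLang t₂ v) hab
      (add_le_formulaCode_equal mulOrdNumbering t₁ t₂)
  | rel R ts =>
    obtain ⟨h1, h2⟩ := formulaCode_rel_ge mulOrdNumbering R ts
    cases R with
    | le =>
      have key : (ts 1).realize (Sum.elim v a) < (ts 0).realize (Sum.elim v a) ↔
          (ts 1).realize (Sum.elim v b) < (ts 0).realize (Sum.elim v b) := by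
        refine (isMonomial_mulOrdLang (ts 1) v).lt_iff (isMonomial_mulOrdLang (ts 0) v) hab ?_
        have h := add_add_two_le_encode_pair (termCode mulOrdNumbering (ts 0))
          (termCode mulOrdNumbering (ts 1))
        have h' : (List.ofFn fun i => termCode mulOrdNumbering (ts i)) =
          [termCode mulOrdNumbering (ts 0), termCode mulOrdNumbering (ts 1)] := rfl
        rw [h'] at h1
        exact (by omega : _ ≤ _).trans (h1.trans (Nat.le_succ _))
      exact not_lt.symm.trans ((not_congr key).trans not_lt)

/-- Every formula is invariant under a sufficiently fine equivalence. -/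
theorem AtomicInvariant.exists_level {L : Language} [L.Structure ℚ] {S : SymbolNumbering L}
    (hS : AtomicInvariant S) {n : ℕ} (φ : L.Formula (Fin n)) :
    ∃ N, ∀ a b : Fin n → ℚ, RatEquiv N a b → (φ.Realize a ↔ φ.Realize b) := by
  -- The free variables are turned into the de Bruijn variables of a formula over `Empty`, for which
  -- Gödel numbers are defined.
  let ψ : L.BoundedFormula Empty (n + 0) :=
    BoundedFormula.relabel (Sum.inr : Fin n → Empty ⊕ Fin n) φ
  have h : ∀ a : Fin n → ℚ, ψ.Realize Empty.elim a ↔ φ.Realize a := by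
    intro a
    rw [BoundedFormula.realize_relabel]
    exact iff_of_eq (congrArg₂ _ (by funext i; rfl) (Subsingleton.elim _ _))
  exact ⟨level (formulaCode S ψ), fun a b hab => by
    rw [← h, ← h]; exact hS.realize_iff ψ _ hab⟩

/-! ### Addition is not definable -/

theorem exists_pow_eq_prime_zpow_iff {p : ℕ} (hp : p.Prime) (m : ℕ) (k : ℤ) :
    (∃ g : PosRat, m • g = k • PosRat.mk p (by exact_mod_cast hp.pos)) ↔ (m : ℤ) ∣ k := by
  have : Fact p.Prime := ⟨hp⟩
  constructor
  · rintro ⟨g, hg⟩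
    have h1 := congrArg (PosRat.valuation p) hg
    have h2 : PosRat.valuation p (PosRat.mk p (by exact_mod_cast hp.pos)) = 1 :=
      padicValRat.self hp.one_lt
    rw [map_nsmul, map_zsmul, h2] at h1
    exact ⟨PosRat.valuation p g, by simpa using h1.symm⟩
  · rintro ⟨s, rfl⟩
    have h : ∀ {G : Type} [AddCommGroup G] (x : G), m • s • x = (m * s : ℤ) • x := fun x => by
      rw [mul_smul, natCast_zsmul]
    exact ⟨s • PosRat.mk p (by exact_mod_cast hp.pos), h _⟩

/-- Combinations of either triple are multiples k•p of one prime p > 1. Such a multiple is positive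
iff 0 < k and divisible by m iff m ∣ k, whichever prime p is. -/
theorem ratEquiv_two_three (N : ℕ) : RatEquiv N ![1, 1, 2] ![1, 1, 3] := by
  refine ⟨fun i => ?_, fun e _ => ?_⟩
  · fin_cases i
    · rfl
    · rfl
    · change SignType.sign (2 : ℚ) = SignType.sign (3 : ℚ)
      rw [sign_pos (by norm_num), sign_pos (by norm_num)]
  · have key : ∀ (p : ℕ) (hp : p.Prime), (intLin e fun i => ratMag ((![1, 1, (p : ℚ)] : Fin 3 → ℚ) i))
        = e 2 • PosRat.mk p (by exact_mod_cast hp.pos) := by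
      intro p hp
      have h : ratMag (p : ℚ) = PosRat.mk p (by exact_mod_cast hp.pos) :=
        PosRat.val_injective (by
          rw [val_ratMag (by exact_mod_cast hp.ne_zero), PosRat.val_mk, Nat.abs_cast])
      simp [intLin, Fin.sum_univ_three, ratMag_one, h, zsmul_zero]
    have hpos : ∀ (p : ℕ) (hp : p.Prime), 0 < e 2 • PosRat.mk p (by exact_mod_cast hp.pos) ↔
        0 < e 2 := by
      intro p hp
      have h : (0 : PosRat) < PosRat.mk p (by exact_mod_cast hp.pos) := by
        rw [PosRat.lt_iff]; simpa using hp.one_lt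
      rcases lt_trichotomy (e 2) 0 with h1 | h1 | h1
      · have h2 := zsmul_pos h (n := -e 2) (by omega)
        rw [neg_zsmul, neg_pos] at h2
        exact iff_of_false h2.not_gt h1.not_gt
      · rw [h1, zero_zsmul]; simp
      · exact iff_of_true (zsmul_pos h h1) h1
    have h2 := key 2 Nat.prime_two
    have h3 := key 3 Nat.prime_three
    push_cast at h2 h3
    rw [h2, h3]
    refine ⟨(hpos 2 Nat.prime_two).trans (hpos 3 Nat.prime_three).symm, fun m _ _ => ?_⟩
    exact (exists_pow_eq_prime_zpow_iff Nat.prime_two m _).trans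
      (exists_pow_eq_prime_zpow_iff Nat.prime_three m _).symm

theorem not_definable_add : ¬ (∅ : Set ℚ).Definable mulOrdLang {v : Fin 3 → ℚ | v 0 + v 1 = v 2} := by
  rw [Set.empty_definable_iff]
  rintro ⟨φ, hφ⟩
  obtain ⟨N, hN⟩ := atomicInvariant_mulOrdNumbering.exists_level φ
  have h := hN _ _ (ratEquiv_two_three N)
  have h' : ∀ v : Fin 3 → ℚ, φ.Realize v ↔ v 0 + v 1 = v 2 := fun v => by
    have := Set.ext_iff.1 hφ v
    exact this.symm
  rw [h', h'] at h
  simp at h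
  norm_num at h

/-! ### Quantifier elimination -/

/-- A property of assignments that is given by a quantifier-free formula. -/
def QFDefinable (L : Language) {M α : Type} [L.Structure M] (P : (α → M) → Prop) : Prop :=
  ∃ ψ : L.Formula α, ψ.IsQF ∧ ∀ v, P v ↔ ψ.Realize v

/-- A property which depends on the truth of finitely many quantifier-free properties is
quantifier-free. -/
theorem QFDefinable.of_forall_mem_iff {L : Language} {M α : Type} [L.Structure M]
    (l : List ((α → M) → Prop)) (hl : ∀ Q ∈ l, QFDefinable L Q) (P : (α → M) → Prop)
    (hP : ∀ v w : α → M, (∀ Q ∈ l, (Q v ↔ Q w)) → P v → P w) : QFDefinable L P := by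
  induction l generalizing P with
  | nil =>
    by_cases h : ∃ v, P v
    · obtain ⟨v, hv⟩ := h
      refine ⟨⊤, BoundedFormula.IsQF.top, fun w => iff_of_true (hP v w (by simp) hv) ?_⟩
      exact BoundedFormula.realize_top.2 trivial
    · exact ⟨⊥, BoundedFormula.IsQF.falsum, fun w =>
        iff_of_false (fun hw => h ⟨w, hw⟩) (by simp [Formula.Realize])⟩
  | cons Q l ih =>
    have hl' : ∀ Q ∈ l, QFDefinable L Q := fun Q' h => hl Q' (List.mem_cons_of_mem _ h)
    obtain ⟨θ, hθ, hθQ⟩ := hl Q List.mem_cons_self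
    -- P is split according to Q. Closing each half under agreement on the remaining list gives a
    -- property that depends on that list only, as the induction hypothesis demands.
    obtain ⟨ψ₁, h1, h1'⟩ := ih hl' (fun v => ∃ w, (∀ Q ∈ l, (Q v ↔ Q w)) ∧ Q w ∧ P w)
      (fun v v' hv ⟨w, hw, hw'⟩ => ⟨w, fun Q' h => (hv Q' h).symm.trans (hw Q' h), hw'⟩)
    obtain ⟨ψ₂, h2, h2'⟩ := ih hl' (fun v => ∃ w, (∀ Q ∈ l, (Q v ↔ Q w)) ∧ ¬ Q w ∧ P w)
      (fun v v' hv ⟨w, hw, hw'⟩ => ⟨w, fun Q' h => (hv Q' h).symm.trans (hw Q' h), hw'⟩)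
    refine ⟨(θ ⊓ ψ₁) ⊔ (∼θ ⊓ ψ₂), (hθ.inf h1).sup (hθ.not.inf h2), fun v => ?_⟩
    have hr : ((θ ⊓ ψ₁) ⊔ (∼θ ⊓ ψ₂) : L.Formula α).Realize v ↔
        (θ.Realize v ∧ ψ₁.Realize v) ∨ (¬ θ.Realize v ∧ ψ₂.Realize v) := by
      simp [Formula.Realize]
    rw [hr, ← h1', ← h2', ← hθQ]
    constructor
    · intro hv
      by_cases h : Q v
      · exact Or.inl ⟨h, v, fun _ _ => Iff.rfl, h, hv⟩
      · exact Or.inr ⟨h, v, fun _ _ => Iff.rfl, h, hv⟩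
    · rintro (⟨h, w, hw, hw', hPw⟩ | ⟨h, w, hw, hw', hPw⟩)
      · refine hP w v (fun Q' h' => ?_) hPw
        rcases List.mem_cons.1 h' with rfl | h'
        · exact iff_of_true hw' h
        · exact (hw Q' h').symm
      · refine hP w v (fun Q' h' => ?_) hPw
        rcases List.mem_cons.1 h' with rfl | h'
        · exact iff_of_false hw' h
        · exact (hw Q' h').symm

/-- A function that is given by a term of `ℒ`. -/
def IsPowTerm {α : Type} (τ : (α → ℚ) → ℚ) : Prop :=
  ∃ t : powLang.Term α, ∀ a, t.realize a = τ a

namespace IsPowTerm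

variable {α : Type} {τ σ : (α → ℚ) → ℚ}

theorem var (i : α) : IsPowTerm fun a : α → ℚ => a i := ⟨.var i, fun _ => rfl⟩

theorem zero : IsPowTerm fun _ : α → ℚ => (0 : ℚ) :=
  ⟨.func (L := powLang) PowFunc.zero ![], fun _ => rfl⟩

theorem one : IsPowTerm fun _ : α → ℚ => (1 : ℚ) :=
  ⟨.func (L := powLang) PowFunc.one ![], fun _ => rfl⟩

theorem mul (hτ : IsPowTerm τ) (hσ : IsPowTerm σ) : IsPowTerm fun a => τ a * σ a := by
  obtain ⟨t, ht⟩ := hτ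
  obtain ⟨s, hs⟩ := hσ
  exact ⟨.func (L := powLang) PowFunc.mul ![t, s], fun a => congrArg₂ (· * ·) (ht a) (hs a)⟩

theorem inv (hτ : IsPowTerm τ) : IsPowTerm fun a => (τ a)⁻¹ := by
  obtain ⟨t, ht⟩ := hτ
  exact ⟨.func (L := powLang) PowFunc.inv ![t], fun a => congrArg (·⁻¹) (ht a)⟩

theorem pow (hτ : IsPowTerm τ) (n : ℕ) : IsPowTerm fun a => τ a ^ n := by
  induction n with
  | zero => simpa using one
  | succ n ih => simpa only [pow_succ] using ih.mul hτ

theorem zpow (hτ : IsPowTerm τ) (k : ℤ) : IsPowTerm fun a => τ a ^ k := by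
  rcases Int.natAbs_eq k with h | h
  · rw [h]; simpa only [zpow_natCast] using hτ.pow k.natAbs
  · rw [h]; simpa only [zpow_neg, zpow_natCast] using (hτ.pow k.natAbs).inv

theorem prod {ι : Type} (s : Finset ι) {τ : ι → (α → ℚ) → ℚ} (hτ : ∀ i, IsPowTerm (τ i)) :
    IsPowTerm fun a => ∏ i ∈ s, τ i a := by
  classical
  induction s using Finset.induction_on with
  | empty => simpa using one
  | insert i s hi ih => simpa only [Finset.prod_insert hi] using (hτ i).mul ih

theorem qfDefinable_lt (hτ : IsPowTerm τ) (hσ : IsPowTerm σ) :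
    QFDefinable powLang fun a => τ a < σ a := by
  obtain ⟨t, ht⟩ := hτ
  obtain ⟨s, hs⟩ := hσ
  refine ⟨Relations.formula (L := powLang) PowRel.lt ![t, s],
    (BoundedFormula.IsAtomic.rel _ _).isQF, fun a => ?_⟩
  refine Iff.trans ?_ (Formula.realize_rel (L := powLang)).symm
  change τ a < σ a ↔ t.realize a < s.realize a
  rw [ht, hs]

theorem qfDefinable_isPow (hτ : IsPowTerm τ) {m : ℕ} (hm : 2 ≤ m) :
    QFDefinable powLang fun a => ∃ y : ℚ, τ a = y ^ m := by
  obtain ⟨t, ht⟩ := hτ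
  refine ⟨Relations.formula (L := powLang) (PowRel.isPow m hm) ![t],
    (BoundedFormula.IsAtomic.rel _ _).isQF, fun a => ?_⟩
  refine Iff.trans ?_ (Formula.realize_rel (L := powLang)).symm
  change (∃ y, τ a = y ^ m) ↔ ∃ y, t.realize a = y ^ m
  rw [ht]

end IsPowTerm

/-- The exponents must vanish at zero coordinates: these count as 1 in the group, while a nonzero
power of 0 would annihilate the product. -/
theorem abs_prod_zpow_eq_val {n : ℕ} {a : Fin n → ℚ} {e : Fin n → ℤ}
    (h : ∀ i, a i = 0 → e i = 0) :
    |∏ i, a i ^ e i| = (intLin e fun i => ratMag (a i)).val := by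
  have hV : ∀ s : Finset (Fin n), |∏ i ∈ s, a i ^ e i| = (∑ i ∈ s, e i • ratMag (a i)).val := by
    intro s
    induction s using Finset.induction_on with
    | empty => simp
    | insert i s hi ih =>
      rw [Finset.prod_insert hi, Finset.sum_insert hi, abs_mul, PosRat.val_add, ih]
      congr 1
      by_cases hai : a i = 0
      · rw [h i hai, zero_zsmul]; simp
      · rw [abs_zpow, ← val_ratMag hai]; rfl
  exact hV Finset.univ

/-- Squaring replaces the absolute value, which is not a term. In the next lemma it turns m-th
powers into 2m-th powers, so the symbol needed exists even for m = 1. -/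
theorem intLin_pos_iff {n : ℕ} {a : Fin n → ℚ} {e : Fin n → ℤ} (h : ∀ i, a i = 0 → e i = 0) :
    0 < intLin e (fun i => ratMag (a i)) ↔ 1 < (∏ i, a i ^ e i) ^ 2 := by
  rw [PosRat.lt_iff, ← abs_prod_zpow_eq_val h, PosRat.val_zero, one_lt_sq_iff_one_lt_abs]

theorem exists_nsmul_eq_intLin_iff {n m : ℕ} (hm : m ≠ 0) {a : Fin n → ℚ} {e : Fin n → ℤ}
    (h : ∀ i, a i = 0 → e i = 0) :
    (∃ g, m • g = intLin e fun i => ratMag (a i)) ↔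
      ∃ y : ℚ, (∏ i, a i ^ e i) ^ 2 = y ^ (2 * m) := by
  have hv := abs_prod_zpow_eq_val h
  have hpos := (intLin e fun i => ratMag (a i)).val_pos
  constructor
  · rintro ⟨g, hg⟩
    refine ⟨g.val, ?_⟩
    rw [← sq_abs, hv, ← hg, PosRat.val_nsmul]
    ring
  · rintro ⟨y, hy⟩
    have hy0 : y ≠ 0 := by
      rintro rfl
      rw [zero_pow (by omega), ← sq_abs, hv] at hy
      exact (pow_pos hpos 2).ne' hy
    refine ⟨PosRat.mk |y| (abs_pos.2 hy0), PosRat.val_injective ?_⟩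
    rw [PosRat.val_nsmul, PosRat.val_mk, ← hv]
    have h1 : |y ^ m| ^ 2 = |∏ i, a i ^ e i| ^ 2 := by
      rw [sq_abs, sq_abs, hy]; ring
    rw [← abs_pow]
    exact (pow_left_inj₀ (abs_nonneg _) (abs_nonneg _) two_ne_zero).1 h1

/-- The formula is invariant under some `RatEquiv N`, and that relation is implied by agreement on a
finite list of quantifier-free properties. So `QFDefinable.of_forall_mem_iff` applies. -/
theorem quantifierElimination_powLang : AdmitsQE powLang ℚ := by
  intro n φ
  obtain ⟨N, hN⟩ := atomicInvariant_powNumbering.exists_level φ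
  let S : Finset (Fin n → ℤ) := Fintype.piFinset fun _ => Finset.Icc (-(N : ℤ)) N
  have hS : ∀ f, f ∈ S ↔ ∀ i, |f i| ≤ N := by
    intro f
    simp [S, abs_le]
  let μ : (Fin n → ℤ) → (Fin n → ℚ) → ℚ := fun e a => (∏ i, a i ^ e i) ^ 2
  have hμ : ∀ e, IsPowTerm (μ e) := fun e =>
    (IsPowTerm.prod _ fun i => (IsPowTerm.var i).zpow (e i)).pow 2
  let l : List ((Fin n → ℚ) → Prop) :=
    ((List.finRange n).map fun i a => a i < 0) ++ ((List.finRange n).map fun i a => 0 < a i) ++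
    (S.toList.map fun e a => 1 < μ e a) ++
    (S.toList.flatMap fun e => (List.range N).map fun m a => ∃ y : ℚ, μ e a = y ^ (2 * (m + 1)))
  refine QFDefinable.of_forall_mem_iff l ?_ (fun a => φ.Realize a) fun a b hab => ?_
  · intro Q hQ
    simp only [l, List.mem_append, List.mem_map, List.mem_flatMap] at hQ
    rcases hQ with ((⟨i, -, rfl⟩ | ⟨i, -, rfl⟩) | ⟨e, -, rfl⟩) | ⟨e, -, m, -, rfl⟩
    · exact (IsPowTerm.var i).qfDefinable_lt IsPowTerm.zero
    · exact IsPowTerm.zero.qfDefinable_lt (IsPowTerm.var i)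
    · exact IsPowTerm.one.qfDefinable_lt (hμ e)
    · exact (hμ e).qfDefinable_isPow (by omega)
  · refine (hN a b ?_).1
    have h1 : ∀ i, a i < 0 ↔ b i < 0 := fun i => hab (fun a => a i < 0) (by simp [l])
    have h2 : ∀ i, 0 < a i ↔ 0 < b i := fun i => hab (fun a => 0 < a i) (by simp [l])
    have h3 : ∀ e ∈ S, (1 < μ e a ↔ 1 < μ e b) := fun e he => hab (fun a => 1 < μ e a) (by
      simp only [l, List.mem_append, List.mem_map]
      exact Or.inl (Or.inr ⟨e, by simpa using he, rfl⟩))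
    have h4 : ∀ e ∈ S, ∀ m < N, ((∃ y : ℚ, μ e a = y ^ (2 * (m + 1))) ↔
        ∃ y : ℚ, μ e b = y ^ (2 * (m + 1))) := fun e he m hm =>
      hab (fun a => ∃ y : ℚ, μ e a = y ^ (2 * (m + 1))) (by
        simp only [l, List.mem_append, List.mem_map, List.mem_flatMap]
        exact Or.inr ⟨e, by simpa using he, m, by simpa using hm, rfl⟩)
    have h0 : ∀ i, a i = 0 ↔ b i = 0 := fun i => by
      have key : ∀ x : ℚ, x = 0 ↔ ¬ x < 0 ∧ ¬ 0 < x := fun x => by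
        rw [not_lt, not_lt, le_antisymm_iff, and_comm]
      rw [key, key (b i), h1, h2]
    refine ⟨fun i => ?_, fun e he => ?_⟩
    · rcases lt_trichotomy (a i) 0 with h | h | h
      · rw [sign_neg h, sign_neg ((h1 i).1 h)]
      · rw [h, (h0 i).1 h]
      · rw [sign_pos h, sign_pos ((h2 i).1 h)]
    · classical
      -- Exponents at zero coordinates do not affect the combination and are dropped. As a and b
      -- vanish at the same places, one e' serves both.
      let e' : Fin n → ℤ := fun i => if a i = 0 then 0 else e i
      have he' : e' ∈ S := by
        rw [hS]
        intro i
        by_cases h : a i = 0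
        · simp [e', h]
        · simpa [e', h] using he i
      have hae : ∀ i, a i = 0 → e' i = 0 := fun i h => by simp [e', h]
      have hbe : ∀ i, b i = 0 → e' i = 0 := fun i h => hae i ((h0 i).2 h)
      have key : ∀ c : Fin n → ℚ, (∀ i, a i = 0 ↔ c i = 0) →
          (intLin e fun i => ratMag (c i)) = intLin e' fun i => ratMag (c i) := by
        intro c hc
        refine Finset.sum_congr rfl fun i _ => ?_
        by_cases h : a i = 0
        · change e i • ratMag (c i) = e' i • ratMag (c i)
          rw [(hc i).1 h, ratMag_zero, zsmul_zero, zsmul_zero]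
        · simp [e', h]
      rw [key a fun _ => Iff.rfl, key b h0]
      refine ⟨?_, fun m hm hmN => ?_⟩
      · rw [intLin_pos_iff hae, intLin_pos_iff hbe]
        exact h3 e' he'
      · rw [exists_nsmul_eq_intLin_iff hm.ne' hae, exists_nsmul_eq_intLin_iff hm.ne' hbe]
        obtain ⟨m, rfl⟩ : ∃ k, m = k + 1 := ⟨m - 1, by omega⟩
        exact h4 e' he' m (by omega)

/-! ### Codes for rationals -/

/-- The code of the rational `(-1)ˢ p / q`. -/
def ratMk (s p q : ℕ) : ℕ := Nat.pair s (Nat.pair p q)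

/-- The rational with a given code. -/
def ratVal (k : ℕ) : ℚ :=
  (-1) ^ k.unpair.1 * ((k.unpair.2.unpair.1 : ℚ) / (k.unpair.2.unpair.2 : ℚ))

theorem ratVal_ratMk (s p q : ℕ) : ratVal (ratMk s p q) = (-1) ^ s * ((p : ℚ) / q) := by
  simp [ratVal, ratMk]

/-- A bound for the codes of the rationals of height at most `B`. -/
def codeBound (B : ℕ) : ℕ := Nat.pair 1 (Nat.pair B B) + 1

theorem pair_le_pair {a b c d : ℕ} (h : a ≤ c) (h' : b ≤ d) : Nat.pair a b ≤ Nat.pair c d :=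
  (h.eq_or_lt.elim (fun h => (congrArg (Nat.pair · b) h).le) fun h =>
      (Nat.pair_lt_pair_left b h).le).trans
    (h'.eq_or_lt.elim (fun h => (congrArg (Nat.pair c ·) h).le) fun h =>
      (Nat.pair_lt_pair_right c h).le)

theorem exists_code_lt {B : ℕ} (hB : 1 ≤ B) {x : ℚ} (hx : (ratMag x).height ≤ B) :
    ∃ j < codeBound B, ratVal j = x := by
  by_cases h0 : x = 0
  · refine ⟨ratMk 0 0 0, Nat.lt_succ_of_le (pair_le_pair (by omega)
      (pair_le_pair (by omega) (by omega))), ?_⟩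
    rw [ratVal_ratMk, h0]; simp
  · have h1 : (ratMag x).val.num.natAbs ≤ B := (le_max_left _ _).trans hx
    have h2 : (ratMag x).val.den ≤ B := (le_max_right _ _).trans hx
    have h3 := PosRat.val_eq_div (ratMag x)
    rw [val_ratMag h0] at h1 h2 h3
    rcases lt_or_gt_of_ne h0 with h | h
    · refine ⟨ratMk 1 |x|.num.natAbs |x|.den, Nat.lt_succ_of_le (pair_le_pair le_rfl
        (pair_le_pair h1 h2)), ?_⟩
      rw [ratVal_ratMk, ← h3, abs_of_neg h]; simp
    · refine ⟨ratMk 0 |x|.num.natAbs |x|.den, Nat.lt_succ_of_le (pair_le_pair (by omega)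
        (pair_le_pair h1 h2)), ?_⟩
      rw [ratVal_ratMk, ← h3, abs_of_pos h]; simp

theorem height_ratVal_le (k : ℕ) : (ratMag (ratVal k)).height ≤ k + 1 := by
  by_cases h0 : ratVal k = 0
  · rw [h0, ratMag_zero, PosRat.height_zero]; omega
  · have hq : 0 < k.unpair.2.unpair.2 := by
      refine Nat.pos_of_ne_zero fun h => h0 ?_
      simp [ratVal, h]
    have h1 : k.unpair.2 ≤ k := Nat.unpair_right_le k
    have h2 := Nat.unpair_left_le k.unpair.2
    have h3 := Nat.unpair_right_le k.unpair.2
    refine PosRat.height_le_of_eq_div hq (p := k.unpair.2.unpair.1) ?_ (by omega) (by omega)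
    rw [val_ratMag h0, ratVal, abs_mul, abs_pow, abs_neg, abs_one, one_pow, one_mul,
      abs_of_nonneg (by positivity)]

/-- Multiplication on codes. -/
def mulCode (k l : ℕ) : ℕ :=
  ratMk (k.unpair.1 + l.unpair.1) (k.unpair.2.unpair.1 * l.unpair.2.unpair.1)
    (k.unpair.2.unpair.2 * l.unpair.2.unpair.2)

theorem ratVal_mulCode (k l : ℕ) : ratVal (mulCode k l) = ratVal k * ratVal l := by
  rw [mulCode, ratVal_ratMk, ratVal, ratVal, pow_add, Nat.cast_mul, Nat.cast_mul,
    ← div_mul_div_comm]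
  ring

/-- Inversion on codes. -/
def invCode (k : ℕ) : ℕ := ratMk k.unpair.1 k.unpair.2.unpair.2 k.unpair.2.unpair.1

theorem ratVal_invCode (k : ℕ) : ratVal (invCode k) = (ratVal k)⁻¹ := by
  rw [invCode, ratVal_ratMk, ratVal, mul_inv, inv_div, ← inv_pow, inv_neg, inv_one]

/-- Powers on codes. -/
def powCode (k n : ℕ) : ℕ :=
  ratMk (k.unpair.1 * n) (k.unpair.2.unpair.1 ^ n) (k.unpair.2.unpair.2 ^ n)

theorem ratVal_powCode (k n : ℕ) : ratVal (powCode k n) = ratVal k ^ n := by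
  rw [powCode, ratVal_ratMk, ratVal, pow_mul, mul_pow, div_pow, Nat.cast_pow, Nat.cast_pow]

/-- A numerator of the absolute value of the rational with code `k`. -/
def codeNum (k : ℕ) : ℕ := k.unpair.2.unpair.1 * min k.unpair.2.unpair.2 1

/-- A denominator of the rational with code `k`. -/
def codeDen (k : ℕ) : ℕ := max k.unpair.2.unpair.2 1

/-- A code with denominator 0 denotes 0. The truncations by 1 in `codeNum` and `codeDen` rewrite it
as 0 / 1, so that comparison by cross-multiplication is legitimate. -/
theorem ratVal_eq (k : ℕ) : ratVal k = (-1) ^ k.unpair.1 * ((codeNum k : ℚ) / codeDen k) := by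
  rw [ratVal, codeNum, codeDen]
  rcases Nat.eq_zero_or_pos k.unpair.2.unpair.2 with h | h
  · simp [h]
  · rw [min_eq_right h, max_eq_left h, mul_one]

/-- The order on codes. -/
def LtCode (k l : ℕ) : Prop :=
  if k.unpair.1 % 2 = 0 then
    l.unpair.1 % 2 = 0 ∧ codeNum k * codeDen l < codeNum l * codeDen k
  else if l.unpair.1 % 2 = 0 then 0 < codeNum k + codeNum l
  else codeNum l * codeDen k < codeNum k * codeDen l

/-- Zero may carry either sign. Hence for k with negative and l with positive sign, the inequality
fails exactly when both numerators vanish. -/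
theorem ltCode_iff (k l : ℕ) : LtCode k l ↔ ratVal k < ratVal l := by
  have hk : (0 : ℚ) < codeDen k := by
    exact_mod_cast lt_of_lt_of_le one_pos (le_max_right k.unpair.2.unpair.2 1)
  have hl : (0 : ℚ) < codeDen l := by
    exact_mod_cast lt_of_lt_of_le one_pos (le_max_right l.unpair.2.unpair.2 1)
  have h1 : (0 : ℚ) ≤ codeNum k / codeDen k := by positivity
  have h2 : (0 : ℚ) ≤ codeNum l / codeDen l := by positivity
  have hlt : codeNum k * codeDen l < codeNum l * codeDen k ↔
      (codeNum k : ℚ) / codeDen k < codeNum l / codeDen l := by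
    rw [div_lt_div_iff₀ hk hl]; exact_mod_cast Iff.rfl
  have hlt' : codeNum l * codeDen k < codeNum k * codeDen l ↔
      (codeNum l : ℚ) / codeDen l < codeNum k / codeDen k := by
    rw [div_lt_div_iff₀ hl hk]; exact_mod_cast Iff.rfl
  rw [LtCode, ratVal_eq k, ratVal_eq l]
  rcases Nat.mod_two_eq_zero_or_one k.unpair.1 with hk2 | hk2 <;>
    rcases Nat.mod_two_eq_zero_or_one l.unpair.1 with hl2 | hl2
  · rw [(Nat.even_iff.2 hk2).neg_one_pow, (Nat.even_iff.2 hl2).neg_one_pow, hlt]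
    simp [hk2, hl2]
  · rw [(Nat.even_iff.2 hk2).neg_one_pow, (Nat.odd_iff.2 hl2).neg_one_pow]
    simp only [hk2, hl2, if_true, one_ne_zero, false_and, false_iff, not_lt]
    linarith
  · rw [(Nat.odd_iff.2 hk2).neg_one_pow, (Nat.even_iff.2 hl2).neg_one_pow]
    simp only [hk2, hl2, if_true, one_ne_zero, if_false]
    rw [one_mul, neg_one_mul]
    constructor
    · intro h
      rcases Nat.eq_zero_or_pos (codeNum k) with h' | h'
      · have h'' : 0 < codeNum l := by omega
        have : (0 : ℚ) < codeNum l / codeDen l := div_pos (by exact_mod_cast h'') hl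
        linarith
      · have : (0 : ℚ) < codeNum k / codeDen k := div_pos (by exact_mod_cast h') hk
        linarith
    · intro h
      by_contra hc
      have h3 : codeNum k = 0 := by omega
      have h4 : codeNum l = 0 := by omega
      simp [h3, h4] at h
  · rw [(Nat.odd_iff.2 hk2).neg_one_pow, (Nat.odd_iff.2 hl2).neg_one_pow, hlt']
    simp [hk2, hl2]

/-- For n > 0 the height of an n-th root is at most that of its power, so the search for a root is
bounded. For n = 0 any code will do. -/
theorem exists_eq_pow_iff_exists_lt (n k : ℕ) : (∃ y : ℚ, ratVal k = y ^ n) ↔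
    ∃ j < codeBound (k + 1), ratVal (powCode j n) = ratVal k := by
  simp only [ratVal_powCode]
  constructor
  · rintro ⟨y, hy⟩
    rcases Nat.eq_zero_or_pos n with rfl | hn
    · exact ⟨0, Nat.succ_pos _, by rw [hy, pow_zero, pow_zero]⟩
    · have h : (ratMag y).height ≤ k + 1 := by
        by_cases hy0 : y = 0
        · rw [hy0, ratMag_zero, PosRat.height_zero]; omega
        · have h1 : n • ratMag y = ratMag (ratVal k) := PosRat.val_injective (by
            rw [PosRat.val_nsmul, hy, val_ratMag hy0, val_ratMag (pow_ne_zero n hy0), abs_pow])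
          exact (PosRat.height_le_height_nsmul hn _).trans (h1 ▸ height_ratVal_le k)
      obtain ⟨j, hj, rfl⟩ := exists_code_lt (Nat.succ_pos k) h
      exact ⟨j, hj, hy.symm⟩
  · rintro ⟨j, -, hj⟩
    exact ⟨ratVal j, hj.symm⟩

/-! ### Primitive recursiveness of the operations on codes -/

theorem primrec_nat_pow : Primrec₂ ((· ^ ·) : ℕ → ℕ → ℕ) := Primrec₂.unpaired'.1 Nat.Primrec.pow

theorem primrec_unpair_fst {α : Type} [Primcodable α] {f : α → ℕ} (hf : Primrec f) :
    Primrec fun x => (f x).unpair.1 := Primrec.fst.comp (Primrec.unpair.comp hf)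

theorem primrec_unpair_snd {α : Type} [Primcodable α] {f : α → ℕ} (hf : Primrec f) :
    Primrec fun x => (f x).unpair.2 := Primrec.snd.comp (Primrec.unpair.comp hf)

theorem primrec_ratMk {α : Type} [Primcodable α] {f g h : α → ℕ} (hf : Primrec f) (hg : Primrec g)
    (hh : Primrec h) : Primrec fun x => ratMk (f x) (g x) (h x) :=
  Primrec₂.natPair.comp hf (Primrec₂.natPair.comp hg hh)

theorem primrec_mulCode : Primrec₂ mulCode :=
  primrec_ratMk
    (Primrec.nat_add.comp (primrec_unpair_fst Primrec.fst) (primrec_unpair_fst Primrec.snd))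
    (Primrec.nat_mul.comp (primrec_unpair_fst (primrec_unpair_snd Primrec.fst))
      (primrec_unpair_fst (primrec_unpair_snd Primrec.snd)))
    (Primrec.nat_mul.comp (primrec_unpair_snd (primrec_unpair_snd Primrec.fst))
      (primrec_unpair_snd (primrec_unpair_snd Primrec.snd)))

theorem primrec_invCode : Primrec invCode :=
  primrec_ratMk (primrec_unpair_fst Primrec.id)
    (primrec_unpair_snd (primrec_unpair_snd Primrec.id))
    (primrec_unpair_fst (primrec_unpair_snd Primrec.id))

theorem primrec_powCode : Primrec₂ powCode :=
  primrec_ratMk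
    (Primrec.nat_mul.comp (primrec_unpair_fst Primrec.fst) Primrec.snd)
    (primrec_nat_pow.comp (primrec_unpair_fst (primrec_unpair_snd Primrec.fst)) Primrec.snd)
    (primrec_nat_pow.comp (primrec_unpair_snd (primrec_unpair_snd Primrec.fst)) Primrec.snd)

theorem primrec_codeNum : Primrec codeNum :=
  Primrec.nat_mul.comp (primrec_unpair_fst (primrec_unpair_snd Primrec.id))
    (Primrec.nat_min.comp (primrec_unpair_snd (primrec_unpair_snd Primrec.id)) (Primrec.const 1))

theorem primrec_codeDen : Primrec codeDen :=
  Primrec.nat_max.comp (primrec_unpair_snd (primrec_unpair_snd Primrec.id)) (Primrec.const 1)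

theorem primrecPred_even {α : Type} [Primcodable α] {f : α → ℕ} (hf : Primrec f) :
    PrimrecPred fun x => f x % 2 = 0 :=
  Primrec.eq.comp (Primrec.nat_mod.comp hf (Primrec.const 2)) (Primrec.const 0)

theorem primrecPred_ite {α : Type} [Primcodable α] {c p q : α → Prop} [DecidablePred c]
    (hc : PrimrecPred c) (hp : PrimrecPred p) (hq : PrimrecPred q) :
    PrimrecPred fun x => if c x then p x else q x := by
  refine ((hc.and hp).or (hc.not.and hq)).of_eq fun x => ?_
  by_cases h : c x <;> simp [h]

theorem primrecRel_ltCode : PrimrecRel LtCode := by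
  have hk : PrimrecPred fun p : ℕ × ℕ => p.1.unpair.1 % 2 = 0 :=
    primrecPred_even (primrec_unpair_fst Primrec.fst)
  have hl : PrimrecPred fun p : ℕ × ℕ => p.2.unpair.1 % 2 = 0 :=
    primrecPred_even (primrec_unpair_fst Primrec.snd)
  have hkl : Primrec fun p : ℕ × ℕ => codeNum p.1 * codeDen p.2 :=
    Primrec.nat_mul.comp (primrec_codeNum.comp Primrec.fst) (primrec_codeDen.comp Primrec.snd)
  have hlk : Primrec fun p : ℕ × ℕ => codeNum p.2 * codeDen p.1 :=
    Primrec.nat_mul.comp (primrec_codeNum.comp Primrec.snd) (primrec_codeDen.comp Primrec.fst)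
  have hadd : PrimrecPred fun p : ℕ × ℕ => 0 < codeNum p.1 + codeNum p.2 :=
    Primrec.nat_lt.comp (Primrec.const 0)
      (Primrec.nat_add.comp (primrec_codeNum.comp Primrec.fst) (primrec_codeNum.comp Primrec.snd))
  have h1 : PrimrecPred fun p : ℕ × ℕ => p.2.unpair.1 % 2 = 0 ∧
      codeNum p.1 * codeDen p.2 < codeNum p.2 * codeDen p.1 := hl.and (Primrec.nat_lt.comp hkl hlk)
  have h2 : PrimrecPred fun p : ℕ × ℕ => codeNum p.2 * codeDen p.1 < codeNum p.1 * codeDen p.2 :=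
    Primrec.nat_lt.comp hlk hkl
  exact primrecPred_ite hk h1 (primrecPred_ite hl hadd h2)

/-- Equality of the rationals with given codes. -/
def EqCode (k l : ℕ) : Prop := ¬ LtCode k l ∧ ¬ LtCode l k

theorem eqCode_iff (k l : ℕ) : EqCode k l ↔ ratVal k = ratVal l := by
  rw [EqCode, ltCode_iff, ltCode_iff, not_lt, not_lt, le_antisymm_iff, and_comm]

theorem primrecRel_eqCode : PrimrecRel EqCode :=
  primrecRel_ltCode.not.and (primrecRel_ltCode.comp Primrec.snd Primrec.fst).not

theorem primrec_codeBound : Primrec codeBound :=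
  Primrec.succ.comp (Primrec₂.natPair.comp (Primrec.const 1)
    (Primrec₂.natPair.comp Primrec.id Primrec.id))

theorem primrecRel_isPow : PrimrecRel fun n k : ℕ => ∃ y : ℚ, ratVal k = y ^ n := by
  have h : PrimrecRel fun (j : ℕ) (p : ℕ × ℕ) => EqCode (powCode j p.1) p.2 :=
    primrecRel_eqCode.comp
      (primrec_powCode.comp Primrec.fst (Primrec.fst.comp Primrec.snd))
      (Primrec.snd.comp Primrec.snd)
  have h' : PrimrecPred fun p : ℕ × ℕ =>
      ∃ j ∈ List.range (codeBound (p.2 + 1)), EqCode (powCode j p.1) p.2 :=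
    h.exists_mem_list.comp (g := fun p => p)
      (Primrec.list_range.comp (primrec_codeBound.comp (Primrec.succ.comp Primrec.snd))) Primrec.id
  refine PrimrecPred.of_eq h' fun p => ?_
  simp only [exists_eq_pow_iff_exists_lt, eqCode_iff, List.mem_range]

/-- The code of the fraction given by a pair of integers. -/
def fracCode (p : ℤ × ℕ) : ℕ :=
  ratMk (Encodable.encode p.1) ((Encodable.encode p.1 + 1) / 2) (p.2 + 1)

/-- Integers are encoded by n ↦ 2n and -(n + 1) ↦ 2n + 1. Parity therefore gives the sign, and half
of the successor gives the absolute value. -/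
theorem ratVal_fracCode (p : ℤ × ℕ) : ratVal (fracCode p) = fracVal p := by
  obtain ⟨z, b⟩ := p
  rw [fracCode, ratVal_ratMk, fracVal]
  rcases z with n | n
  · have h : Encodable.encode (Int.ofNat n) = 2 * n := rfl
    have h2 : (2 * n + 1) / 2 = n := by omega
    rw [h, h2]
    simp [pow_mul]
  · have h : Encodable.encode (Int.negSucc n) = 2 * n + 1 := rfl
    have h2 : (2 * n + 1 + 1) / 2 = n + 1 := by omega
    rw [h, h2, Int.cast_negSucc]
    simp only [pow_add, pow_mul]
    push_cast
    ring

theorem primrec_fracCode : Primrec fracCode :=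
  primrec_ratMk (Primrec.encode.comp Primrec.fst)
    (Primrec.nat_div.comp (Primrec.succ.comp (Primrec.encode.comp Primrec.fst)) (Primrec.const 2))
    (Primrec.succ.comp Primrec.snd)

theorem computablePred_isPow :
    ComputablePred fun p : (ℤ × ℕ) × ℕ => ∃ y : ℚ, fracVal p.1 = y ^ p.2 := by
  refine PrimrecPred.computablePred (PrimrecPred.of_eq (primrecRel_isPow.comp Primrec.snd
    (primrec_fracCode.comp Primrec.fst)) fun p => ?_)
  rw [ratVal_fracCode]

theorem primrec_factorial : Primrec Nat.factorial := by
  refine (Primrec.nat_rec₁ 1 (Primrec.nat_mul.comp (Primrec.succ.comp Primrec.fst)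
    Primrec.snd).to₂).of_eq fun n => ?_
  induction n with
  | zero => rfl
  | succ n ih => rw [Nat.factorial_succ, ← ih]

theorem primrec_level : Primrec level := by
  refine Primrec.nat_rec₁ 1 (Primrec.to₂ (f := fun p : ℕ × ℕ => levelStep p.2) ?_)
  exact Primrec.nat_mul.comp
    (Primrec.nat_mul.comp (Primrec.const 2) (primrec_factorial.comp Primrec.snd))
    (primrec_nat_pow.comp Primrec.snd (Primrec.const 2))

theorem primrec_denseBound : Primrec₂ PosRat.denseBound :=
  Primrec.succ.comp (Primrec.nat_mul.comp Primrec.snd (Primrec.nat_mul.comp Primrec.snd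
    (Primrec.nat_mul.comp Primrec.fst (Primrec.succ.comp
      (primrec_nat_pow.comp Primrec.snd (Primrec.const 2))))))

theorem primrec_witnessBound {α : Type} [Primcodable α] {N n A : α → ℕ} (hN : Primrec N)
    (hn : Primrec n) (hA : Primrec A) : Primrec fun x => witnessBound (N x) (n x) (A x) := by
  have hM : Primrec fun x => (N x).factorial := primrec_factorial.comp hN
  have h1 : Primrec fun x => A x ^ (n x * ((N x).factorial * N x)) :=
    primrec_nat_pow.comp hA (Primrec.nat_mul.comp hn (Primrec.nat_mul.comp hM hN))
  have h2 : Primrec fun x =>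
      A x ^ (n x * (N x).factorial) * ((A x).factorial + 1) ^ (N x).factorial :=
    Primrec.nat_mul.comp (primrec_nat_pow.comp hA (Primrec.nat_mul.comp hn hM))
      (primrec_nat_pow.comp (Primrec.succ.comp (primrec_factorial.comp hA)) hM)
  exact Primrec.nat_add.comp h1 (Primrec.nat_mul.comp h2 (primrec_nat_pow.comp
    (primrec_denseBound.comp (Primrec.nat_mul.comp hM hM) (Primrec.nat_mul.comp
      (Primrec.nat_mul.comp (Primrec.const 2) h1) (primrec_nat_pow.comp h2 hM))) hM))

/-! ### Evaluation of terms and formulas from their Gödel numbers -/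

/-- The list of the values of a list of options, if they are all defined. -/
def optSeq {β : Type} (l : List (Option β)) : Option (List β) :=
  l.foldr (fun o acc => o.bind fun x => acc.map (x :: ·)) (some [])

theorem optSeq_eq_some_iff {β : Type} {l : List (Option β)} {r : List β} :
    optSeq l = some r ↔ l = r.map some := by
  induction l generalizing r with
  | nil => cases r <;> simp [optSeq]
  | cons o l ih =>
    have h : optSeq (o :: l) = o.bind fun x => (optSeq l).map (x :: ·) := rfl
    rw [h]
    cases r with
    | nil => simp [Option.bind_eq_some_iff]
    | cons x r =>
      simp only [Option.bind_eq_some_iff, Option.map_eq_some_iff, List.map_cons, List.cons.injEq]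
      constructor
      · rintro ⟨y, rfl, s, hs, rfl, rfl⟩
        exact ⟨rfl, ih.1 hs⟩
      · rintro ⟨rfl, hl⟩
        exact ⟨x, rfl, r, ih.2 hl, rfl, rfl⟩

theorem primrec_optSeq {β : Type} [Primcodable β] : Primrec (optSeq (β := β)) := by
  have h : Primrec fun p : (List (Option β) × Option β × Option (List β)) =>
      p.2.1.bind fun x => p.2.2.map (x :: ·) :=
    Primrec.option_bind (Primrec.fst.comp Primrec.snd)
      (Primrec.option_map (Primrec.snd.comp (Primrec.snd.comp Primrec.fst))
        (Primrec.list_cons.comp (Primrec.snd.comp Primrec.fst) Primrec.snd).to₂).to₂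
  exact Primrec.list_foldr Primrec.id (Primrec.const (some [])) h.to₂

/-- Primitive recursive operations on codes of rationals that compute the function and relation
symbols of a language, given by their numbers; they are undefined on invalid arguments. -/
structure CodedInterpretation {L : Language} [L.Structure ℚ] (S : SymbolNumbering L) where
  fn : ℕ → List ℕ → Option ℕ
  fn_primrec : Primrec₂ fn
  fn_spec : ∀ {k : ℕ} (f : L.Functions k) (x : Fin k → ℕ), ∃ r,
    fn (S.func ⟨k, f⟩) (List.ofFn x) = some r ∧ ratVal r = Structure.funMap f fun i => ratVal (x i)
  fn_some : ∀ {i l r}, fn i l = some r → ∃ f : L.Functions l.length, S.func ⟨_, f⟩ = i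
  rel : ℕ → List ℕ → Option Bool
  rel_primrec : Primrec₂ rel
  rel_spec : ∀ {k : ℕ} (R : L.Relations k) (x : Fin k → ℕ), ∃ b,
    rel (S.rel ⟨k, R⟩) (List.ofFn x) = some b ∧
      (b = true ↔ Structure.RelMap R fun i => ratVal (x i))
  rel_some : ∀ {i l b}, rel i l = some b → ∃ R : L.Relations l.length, S.rel ⟨_, R⟩ = i

/-- The list of the codes of the arguments in the code of a term or of an atomic formula. -/
def argList (c : ℕ) : List ℕ := Denumerable.ofNat (List ℕ) c.unpair.2.unpair.2

theorem argList_pair (t i : ℕ) (l : List ℕ) :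
    argList (Nat.pair t (Nat.pair i (Encodable.encode l))) = l := by
  simp [argList]

theorem lt_of_mem_argList {c y : ℕ} (h : y ∈ argList c) : y < c := by
  have h1 := lt_encode_of_mem h
  rw [argList, Denumerable.encode_ofNat] at h1
  exact h1.trans_le ((Nat.unpair_right_le _).trans (Nat.unpair_right_le _))

theorem primrec_argList : Primrec argList :=
  (Primrec.ofNat (List ℕ)).comp (primrec_unpair_snd (primrec_unpair_snd Primrec.id))

namespace CodedInterpretation

variable {L : Language} [L.Structure ℚ] {S : SymbolNumbering L} (I : CodedInterpretation S)

/-- The value of a term in terms of the values of its arguments. -/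
def termStep (a : List ℕ) (c : ℕ) (vs : List (Option ℕ)) : Option ℕ :=
  if c.unpair.1 = 0 then a[c.unpair.2]?
  else if c.unpair.1 = 1 then (optSeq vs).bind (I.fn c.unpair.2.unpair.1)
  else none

/-- The value of the term with code `c` under the assignment `a`. -/
def termEval (a : List ℕ) (c : ℕ) : Option ℕ :=
  I.termStep a c ((argList c).attach.map fun y => termEval a y.1)
termination_by c
decreasing_by exact lt_of_mem_argList y.2

theorem termEval_eq (a : List ℕ) (c : ℕ) :
    I.termEval a c = I.termStep a c ((argList c).map (I.termEval a)) := by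
  conv_lhs => rw [termEval]
  rw [List.attach_map_val]

/-- Course-of-values recursion: the value at c depends on the values at the codes of the arguments,
which are smaller than c. -/
theorem primrec_termEval : Primrec₂ I.termEval := by
  refine Primrec.nat_omega_rec I.termEval (m := fun _ c => c) (l := fun _ c => argList c)
    (g := fun a p => some (I.termStep a p.1 p.2)) Primrec₂.right
    (primrec_argList.comp₂ Primrec₂.right) ?_ (fun _ _ _ h => lt_of_mem_argList h)
    fun a c => by rw [termEval_eq I a c]
  have hc : Primrec fun p : List ℕ × ℕ × List (Option ℕ) => p.2.1 := Primrec.fst.comp Primrec.snd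
  refine Primrec.option_some.comp ?_
  refine Primrec.ite (Primrec.eq.comp (primrec_unpair_fst hc) (Primrec.const 0))
    (Primrec.list_getElem?.comp Primrec.fst (primrec_unpair_snd hc))
    (Primrec.ite (Primrec.eq.comp (primrec_unpair_fst hc) (Primrec.const 1)) ?_ (Primrec.const none))
  exact Primrec.option_bind (primrec_optSeq.comp (Primrec.snd.comp Primrec.snd))
    (I.fn_primrec.comp (primrec_unpair_fst (primrec_unpair_snd (hc.comp Primrec.fst)))
      Primrec.snd).to₂

/-- The assignment of the variables given by a list of codes. -/
def assignment {n : ℕ} (a : List ℕ) (i : Fin n) : ℚ := ratVal (a.getD i 0)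

theorem termEval_termCode {n : ℕ} (t : L.Term (Empty ⊕ Fin n)) (v : Empty → ℚ) {a : List ℕ}
    (ha : a.length = n) :
    ∃ r, I.termEval a (termCode S t) = some r ∧ ratVal r = t.realize (Sum.elim v (assignment a)) := by
  induction t with
  | var i =>
    rcases i with i | i
    · exact i.elim
    · refine ⟨a.getD i 0, ?_, rfl⟩
      have hi : (i : ℕ) < a.length := ha ▸ i.2
      rw [termEval_eq, termCode]
      simp [termStep, hi]
  | func f ts ih =>
    choose x hx hx' using ih
    obtain ⟨r, hr, hr'⟩ := I.fn_spec f x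
    refine ⟨r, ?_, ?_⟩
    · rw [termEval_eq, termCode, argList_pair]
      have h : (List.ofFn fun i => termCode S (ts i)).map (I.termEval a) =
          (List.ofFn x).map some := by
        rw [List.map_ofFn, List.map_ofFn]
        congr 1
        funext i
        exact hx i
      rw [h, termStep, optSeq_eq_some_iff.2 rfl]
      simpa using hr
    · rw [hr', Term.realize]
      congr 1
      funext i
      exact hx' i

/-- Evaluation doubles as a syntax check. A successful lookup puts the variable index in range, and
`fn_some` recovers a function symbol of the right arity. -/
theorem exists_termCode_eq {a : List ℕ} {n : ℕ} (ha : a.length = n) {c r : ℕ}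
    (h : I.termEval a c = some r) : ∃ t : L.Term (Empty ⊕ Fin n), termCode S t = c := by
  induction c using Nat.strong_induction_on generalizing r with
  | _ c ih =>
    rw [termEval_eq, termStep] at h
    split_ifs at h with h0 h1
    · obtain ⟨hlt, -⟩ := List.getElem?_eq_some_iff.1 h
      refine ⟨.var (.inr ⟨c.unpair.2, ha ▸ hlt⟩), ?_⟩
      rw [termCode, ← h0]
      exact Nat.pair_unpair c
    · obtain ⟨l, hl, hfn⟩ := Option.bind_eq_some_iff.1 h
      rw [optSeq_eq_some_iff] at hl
      have hlen : (argList c).length = l.length := by simpa using congrArg List.length hl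
      obtain ⟨f, hf⟩ := I.fn_some hfn
      have hts : ∀ i : Fin l.length, ∃ t : L.Term (Empty ⊕ Fin n),
          termCode S t = (argList c)[i.1]'(by rw [hlen]; exact i.2) := by
        intro i
        have hi : i.1 < (argList c).length := by rw [hlen]; exact i.2
        refine ih _ (lt_of_mem_argList (List.getElem_mem hi)) (r := l[i.1]) ?_
        have := congrArg (fun m => m[i.1]?) hl
        simpa [hi] using this
      choose ts hts using hts
      refine ⟨.func f ts, ?_⟩
      have hl' : (List.ofFn fun i => termCode S (ts i)) = argList c := by
        refine List.ext_getElem (by simp [hlen]) fun i h1 h2 => ?_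
        simp [hts]
      rw [termCode, hl', hf, argList, Denumerable.encode_ofNat, Nat.pair_unpair, ← h1,
        Nat.pair_unpair]

end CodedInterpretation

instance : DecidableRel LtCode := fun k l => by unfold LtCode; infer_instance

instance : DecidableRel EqCode := fun k l => by unfold EqCode; infer_instance

theorem unpair_snd_lt {c : ℕ} (h : c.unpair.1 ≠ 0) : c.unpair.2 < c := by
  have := Nat.add_le_pair c.unpair.1 c.unpair.2
  rw [Nat.pair_unpair] at this
  omega

namespace CodedInterpretation

variable {L : Language} [L.Structure ℚ] {S : SymbolNumbering L} (I : CodedInterpretation S)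
  (quant : Bool) (W : ℕ → List ℕ → ℕ)

/-- The codes and assignments on which the evaluation of a formula depends; a quantifier ranges
over the codes below the bound `W`. -/
def subList (p : ℕ × List ℕ) : List (ℕ × List ℕ) :=
  if p.1.unpair.1 = 3 then [(p.1.unpair.2.unpair.1, p.2), (p.1.unpair.2.unpair.2, p.2)]
  else if p.1.unpair.1 = 4 ∧ quant = true then
    (List.range (W p.1.unpair.2 p.2)).map fun k => (p.1.unpair.2, p.2 ++ [k])
  else []

theorem lt_of_mem_subList {p p' : ℕ × List ℕ} (h : p' ∈ subList quant W p) : p'.1 < p.1 := by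
  rw [subList] at h
  split_ifs at h with h3 h4
  · have hlt := unpair_snd_lt (c := p.1) (by omega)
    rcases List.mem_pair.1 h with rfl | rfl
    · exact (Nat.unpair_left_le _).trans_lt hlt
    · exact (Nat.unpair_right_le _).trans_lt hlt
  · obtain ⟨k, -, rfl⟩ := List.mem_map.1 h
    exact unpair_snd_lt (by omega)
  · simp at h

/-- The truth value of a formula in terms of the truth values of its parts. -/
def formulaStep (p : ℕ × List ℕ) (vs : List (Option Bool)) : Option Bool :=
  if p.1.unpair.1 = 0 then (if p.1.unpair.2 = 0 then some false else none)
  else if p.1.unpair.1 = 1 then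
    (I.termEval p.2 p.1.unpair.2.unpair.1).bind fun r =>
      (I.termEval p.2 p.1.unpair.2.unpair.2).map fun s => decide (EqCode r s)
  else if p.1.unpair.1 = 2 then
    (optSeq ((argList p.1).map (I.termEval p.2))).bind (I.rel p.1.unpair.2.unpair.1)
  else if p.1.unpair.1 = 3 then
    (optSeq vs).map fun bs => !(bs.getD 0 false) || bs.getD 1 false
  else if p.1.unpair.1 = 4 ∧ quant = true then
    (optSeq vs).map fun bs => decide (∀ b ∈ bs, b = true)
  else none

/-- The truth value of the formula with code `p.1` under the assignment `p.2`. Quantifiers are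
rejected unless `quant` is true. -/
def formulaEval (p : ℕ × List ℕ) : Option Bool :=
  I.formulaStep quant p ((subList quant W p).attach.map fun y => formulaEval y.1)
termination_by p.1
decreasing_by exact lt_of_mem_subList quant W y.2

theorem formulaEval_eq (p : ℕ × List ℕ) : I.formulaEval quant W p =
    I.formulaStep quant p ((subList quant W p).map (I.formulaEval quant W)) := by
  conv_lhs => rw [formulaEval]
  rw [List.attach_map_val]

theorem primrec_subList (hW : Primrec₂ W) : Primrec (subList quant W) := by
  have hb : Primrec fun p : ℕ × List ℕ => p.1.unpair.2 := primrec_unpair_snd Primrec.fst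
  have htag : ∀ t : ℕ, PrimrecPred fun p : ℕ × List ℕ => p.1.unpair.1 = t := fun t =>
    Primrec.eq.comp (primrec_unpair_fst Primrec.fst) (Primrec.const t)
  refine Primrec.ite (htag 3) ?_
    (Primrec.ite ((htag 4).and (?_ : PrimrecPred fun _ => quant = true)) ?_ (Primrec.const []))
  · exact Primrec.list_cons.comp (Primrec.pair (primrec_unpair_fst hb) Primrec.snd)
      (Primrec.list_cons.comp (Primrec.pair (primrec_unpair_snd hb) Primrec.snd) (Primrec.const []))
  · exact Primrec.eq.comp (Primrec.const quant) (Primrec.const true)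
  · exact Primrec.list_map (Primrec.list_range.comp (hW.comp hb Primrec.snd))
      (Primrec.pair (hb.comp Primrec.fst)
        (Primrec.list_concat.comp (Primrec.snd.comp Primrec.fst) Primrec.snd)).to₂

theorem primrec_formulaStep : Primrec₂ (I.formulaStep quant) := by
  have hc : Primrec fun x : (ℕ × List ℕ) × List (Option Bool) => x.1.1 :=
    Primrec.fst.comp Primrec.fst
  have ha : Primrec fun x : (ℕ × List ℕ) × List (Option Bool) => x.1.2 :=
    Primrec.snd.comp Primrec.fst
  have hb : Primrec fun x : (ℕ × List ℕ) × List (Option Bool) => x.1.1.unpair.2 :=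
    primrec_unpair_snd hc
  have hvs : Primrec fun x : (ℕ × List ℕ) × List (Option Bool) => optSeq x.2 :=
    primrec_optSeq.comp Primrec.snd
  have htag : ∀ t : ℕ, PrimrecPred fun x : (ℕ × List ℕ) × List (Option Bool) =>
      x.1.1.unpair.1 = t := fun t =>
    Primrec.eq.comp (primrec_unpair_fst hc) (Primrec.const t)
  have hquant : PrimrecPred fun _ : (ℕ × List ℕ) × List (Option Bool) => quant = true :=
    Primrec.eq.comp (Primrec.const quant) (Primrec.const true)
  have heq : Primrec fun x : (ℕ × List ℕ) × List (Option Bool) =>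
      (I.termEval x.1.2 x.1.1.unpair.2.unpair.1).bind fun r =>
        (I.termEval x.1.2 x.1.1.unpair.2.unpair.2).map fun s => decide (EqCode r s) := by
    have h1 : Primrec₂ fun (y : ((ℕ × List ℕ) × List (Option Bool)) × ℕ) (s : ℕ) =>
        decide (EqCode y.2 s) :=
      primrecRel_eqCode.decide.comp (Primrec.snd.comp Primrec.fst) Primrec.snd
    have h2 : Primrec fun y : ((ℕ × List ℕ) × List (Option Bool)) × ℕ =>
        (I.termEval y.1.1.2 y.1.1.1.unpair.2.unpair.2).map fun s => decide (EqCode y.2 s) :=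
      Primrec.option_map (I.primrec_termEval.comp (ha.comp Primrec.fst)
        (primrec_unpair_snd (hb.comp Primrec.fst))) h1
    exact Primrec.option_bind (I.primrec_termEval.comp ha (primrec_unpair_fst hb)) h2.to₂
  have himp : Primrec fun bs : List Bool => !(bs.getD 0 false) || bs.getD 1 false :=
    Primrec.or.comp (Primrec.not.comp
      ((Primrec.list_getD false).comp Primrec.id (Primrec.const 0)))
      ((Primrec.list_getD false).comp Primrec.id (Primrec.const 1))
  have hall : Primrec fun bs : List Bool => decide (∀ b ∈ bs, b = true) := by
    have h : PrimrecPred fun b : Bool => b = true :=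
      Primrec.eq.comp Primrec.id (Primrec.const true)
    exact h.forall_mem_list.decide
  refine Primrec.ite (htag 0) (Primrec.ite (Primrec.eq.comp hb (Primrec.const 0))
    (Primrec.const (some false)) (Primrec.const none)) (Primrec.ite (htag 1) heq
    (Primrec.ite (htag 2) ?_ (Primrec.ite (htag 3)
      (Primrec.option_map hvs (himp.comp₂ Primrec₂.right)) (Primrec.ite ((htag 4).and hquant)
        (Primrec.option_map hvs (hall.comp₂ Primrec₂.right)) (Primrec.const none)))))
  refine Primrec.option_bind (primrec_optSeq.comp (Primrec.list_map (primrec_argList.comp hc)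
    (I.primrec_termEval.comp (ha.comp Primrec.fst) Primrec.snd).to₂)) ?_
  exact (I.rel_primrec.comp (primrec_unpair_fst (hb.comp Primrec.fst)) Primrec.snd).to₂

/-- A quantifier changes the assignment, so the recursion runs over pairs, with the code alone as
decreasing measure. -/
theorem primrec_formulaEval (hW : Primrec₂ W) : Primrec (I.formulaEval quant W) :=
  Primrec.nat_omega_rec' (I.formulaEval quant W) (m := Prod.fst) (l := subList quant W)
    (g := fun p vs => some (I.formulaStep quant p vs)) Primrec.fst (primrec_subList quant W hW)
    (Primrec.option_some.comp₂ (I.primrec_formulaStep quant))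
    (fun _ _ h => lt_of_mem_subList quant W h) fun p => by rw [formulaEval_eq]

theorem assignment_append {n : ℕ} {a : List ℕ} (ha : a.length = n) (k : ℕ) :
    (assignment (a ++ [k]) : Fin (n + 1) → ℚ) = Fin.snoc (assignment a) (ratVal k) := by
  subst ha
  funext i
  refine Fin.lastCases ?_ (fun i => ?_) i
  · rw [Fin.snoc_last]
    simp [assignment]
  · rw [Fin.snoc_castSucc]
    simp [assignment]

/-- The quantifiers over the rationals may be restricted to the codes below the bound `W`. -/
def IsWitnessBound (S : SymbolNumbering L) (W : ℕ → List ℕ → ℕ) : Prop :=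
  (∀ c a, 0 < W c a) ∧
  ∀ (a : List ℕ) (φ : L.BoundedFormula Empty (a.length + 1)) (v : Empty → ℚ),
    (∀ k < W (formulaCode S φ) a, φ.Realize v (Fin.snoc (assignment a) (ratVal k))) →
      ∀ x : ℚ, φ.Realize v (Fin.snoc (assignment a) x)

theorem formulaEval_formulaCode (hW : quant = true → IsWitnessBound S W) {n : ℕ}
    (φ : L.BoundedFormula Empty n) (hφ : quant = true ∨ φ.IsQF) (v : Empty → ℚ) {a : List ℕ}
    (ha : a.length = n) : ∃ b, I.formulaEval quant W (formulaCode S φ, a) = some b ∧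
      (b = true ↔ φ.Realize v (assignment a)) := by
  induction φ generalizing a with
  | falsum =>
    refine ⟨false, ?_, by simp [BoundedFormula.Realize]⟩
    rw [formulaEval_eq, formulaCode]
    simp [formulaStep]
  | equal t₁ t₂ =>
    obtain ⟨r, hr, hr'⟩ := I.termEval_termCode t₁ v ha
    obtain ⟨s, hs, hs'⟩ := I.termEval_termCode t₂ v ha
    refine ⟨decide (EqCode r s), ?_, ?_⟩
    · rw [formulaEval_eq, formulaCode]
      simp [formulaStep, hr, hs]
    · rw [decide_eq_true_iff, eqCode_iff, hr', hs', BoundedFormula.Realize]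
  | rel R ts =>
    choose x hx hx' using fun i => I.termEval_termCode (ts i) v ha
    obtain ⟨b, hb, hb'⟩ := I.rel_spec R x
    refine ⟨b, ?_, ?_⟩
    · have h : (List.ofFn fun i => termCode S (ts i)).map (I.termEval a) =
          (List.ofFn x).map some := by
        rw [List.map_ofFn, List.map_ofFn]
        congr 1
        funext i
        exact hx i
      rw [formulaEval_eq, formulaCode, formulaStep]
      simp only [argList_pair, h, optSeq_eq_some_iff.2 rfl]
      simpa using hb
    · rw [hb', BoundedFormula.Realize]
      simp only [hx']
  | imp φ ψ ih1 ih2 =>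
    have hφψ : (quant = true ∨ φ.IsQF) ∧ (quant = true ∨ ψ.IsQF) := by
      rcases hφ with h | h
      · exact ⟨Or.inl h, Or.inl h⟩
      · cases h with
        | of_isAtomic h => cases h
        | imp h1 h2 => exact ⟨Or.inr h1, Or.inr h2⟩
    obtain ⟨b, hb, hb'⟩ := ih1 hφψ.1 ha
    obtain ⟨b', hb1, hb1'⟩ := ih2 hφψ.2 ha
    refine ⟨!b || b', ?_, ?_⟩
    · have h : (subList quant W (formulaCode S (φ.imp ψ), a)).map (I.formulaEval quant W) =
          [b, b'].map some := by
        simp [subList, formulaCode, hb, hb1]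
      rw [formulaEval_eq, h, formulaStep, optSeq_eq_some_iff.2 rfl]
      simp [formulaCode]
    · rw [BoundedFormula.realize_imp, ← hb', ← hb1']
      cases b <;> cases b' <;> simp
  | all φ ih =>
    have hq : quant = true := by
      rcases hφ with h | h
      · exact h
      · cases h with
        | of_isAtomic h => cases h
    subst ha hq
    have ih' : ∀ k, ∃ b, I.formulaEval true W (formulaCode S φ, a ++ [k]) = some b ∧
        (b = true ↔ φ.Realize v (Fin.snoc (assignment a) (ratVal k))) := fun k => by
      rw [← assignment_append rfl]
      exact ih (Or.inl rfl) (by simp)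
    choose b hb hb' using ih'
    let bs := (List.range (W (formulaCode S φ) a)).map b
    refine ⟨decide (∀ b ∈ bs, b = true), ?_, ?_⟩
    · have h : (subList true W (formulaCode S φ.all, a)).map (I.formulaEval true W) =
          bs.map some := by
        simp [subList, formulaCode, bs, hb, Function.comp_def]
      rw [formulaEval_eq, h, formulaStep, optSeq_eq_some_iff.2 rfl]
      simp [formulaCode]
    · rw [decide_eq_true_iff, BoundedFormula.realize_all]
      simp only [bs, List.mem_map, List.mem_range, forall_exists_index, and_imp,
        forall_apply_eq_imp_iff₂, hb']
      exact ⟨(hW rfl).2 a φ v, fun h k _ => h _⟩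

/-- Positivity of W is essential for the syntax check: it makes every quantifier evaluate its body
at least once, and with an empty range an invalid body would be accepted. -/
theorem exists_formulaCode_eq (hW : ∀ c a, 0 < W c a) {n c : ℕ} {a : List ℕ} (ha : a.length = n)
    {b : Bool} (h : I.formulaEval quant W (c, a) = some b) :
    ∃ φ : L.BoundedFormula Empty n, (quant = true ∨ φ.IsQF) ∧ formulaCode S φ = c := by
  induction c using Nat.strong_induction_on generalizing n a b with
  | _ c ih =>
    rw [formulaEval_eq, formulaStep] at h
    split_ifs at h with h0 hz h1 h2 h3 h4
    · refine ⟨.falsum, Or.inr .falsum, ?_⟩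
      rw [formulaCode]
      conv_rhs => rw [← Nat.pair_unpair c]
      rw [show c.unpair.1 = 0 from h0, show c.unpair.2 = 0 from hz]
    · obtain ⟨r, hr, h⟩ := Option.bind_eq_some_iff.1 h
      obtain ⟨s, hs, -⟩ := Option.map_eq_some_iff.1 h
      obtain ⟨t₁, ht₁⟩ := I.exists_termCode_eq ha hr
      obtain ⟨t₂, ht₂⟩ := I.exists_termCode_eq ha hs
      refine ⟨.equal t₁ t₂, Or.inr (.of_isAtomic (.equal t₁ t₂)), ?_⟩
      rw [formulaCode, ht₁, ht₂, Nat.pair_unpair, ← h1, Nat.pair_unpair]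
    · obtain ⟨l, hl, hrel⟩ := Option.bind_eq_some_iff.1 h
      rw [optSeq_eq_some_iff] at hl
      have hlen : (argList c).length = l.length := by simpa using congrArg List.length hl
      obtain ⟨R, hR⟩ := I.rel_some hrel
      have hts : ∀ i : Fin l.length, ∃ t : L.Term (Empty ⊕ Fin n),
          termCode S t = (argList c)[i.1]'(by rw [hlen]; exact i.2) := by
        intro i
        have hi : i.1 < (argList c).length := by rw [hlen]; exact i.2
        refine I.exists_termCode_eq ha (r := l[i.1]) ?_
        have := congrArg (fun m => m[i.1]?) hl
        simpa [hi] using this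
      choose ts hts using hts
      refine ⟨.rel R ts, Or.inr (.of_isAtomic (.rel R ts)), ?_⟩
      have hl' : (List.ofFn fun i => termCode S (ts i)) = argList c := by
        refine List.ext_getElem (by simp [hlen]) fun i h1 h2 => ?_
        simp [hts]
      rw [formulaCode, hl', hR, argList, Denumerable.encode_ofNat, Nat.pair_unpair, ← h2,
        Nat.pair_unpair]
    · obtain ⟨bs, hbs, -⟩ := Option.map_eq_some_iff.1 h
      rw [optSeq_eq_some_iff] at hbs
      have hlt := unpair_snd_lt (c := c) (by simpa using h0)
      have hsub : ∀ y ∈ subList quant W (c, a), ∃ b, I.formulaEval quant W y = some b := by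
        intro y hy
        have := List.mem_map_of_mem (f := I.formulaEval quant W) hy
        rw [hbs] at this
        obtain ⟨b, -, hb⟩ := List.mem_map.1 this
        exact ⟨b, hb.symm⟩
      rw [subList, if_pos h3] at hsub
      obtain ⟨b₁, hb₁⟩ := hsub (c.unpair.2.unpair.1, a) (by simp)
      obtain ⟨b₂, hb₂⟩ := hsub (c.unpair.2.unpair.2, a) (by simp)
      obtain ⟨φ, hφ, hφc⟩ := ih _ ((Nat.unpair_left_le _).trans_lt hlt) ha hb₁
      obtain ⟨ψ, hψ, hψc⟩ := ih _ ((Nat.unpair_right_le _).trans_lt hlt) ha hb₂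
      refine ⟨φ.imp ψ, ?_, ?_⟩
      · rcases hφ with h | h
        · exact Or.inl h
        · rcases hψ with h' | h'
          · exact Or.inl h'
          · exact Or.inr (h.imp h')
      · rw [formulaCode, hφc, hψc, Nat.pair_unpair, ← h3, Nat.pair_unpair]
    · obtain ⟨bs, hbs, -⟩ := Option.map_eq_some_iff.1 h
      rw [optSeq_eq_some_iff] at hbs
      have hmem : (c.unpair.2, a ++ [0]) ∈ subList quant W (c, a) := by
        rw [subList, if_neg (by simpa using h3), if_pos h4]
        exact List.mem_map.2 ⟨0, List.mem_range.2 (hW _ _), rfl⟩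
      have := List.mem_map_of_mem (f := I.formulaEval quant W) hmem
      rw [hbs] at this
      obtain ⟨b', -, hb'⟩ := List.mem_map.1 this
      obtain ⟨φ, -, hφc⟩ := ih _ (unpair_snd_lt (by simpa using h0)) (n := n + 1) (by simp [ha])
        hb'.symm
      refine ⟨φ.all, Or.inl h4.2, ?_⟩
      rw [formulaCode, hφc, ← h4.1, Nat.pair_unpair]

/-- The evaluation is correct and detects the valid codes. -/
theorem formulaEval_eq_some_true_iff (hW : ∀ c a, 0 < W c a)
    (hW' : quant = true → IsWitnessBound S W) (v : Empty → ℚ) {n c : ℕ} {a : List ℕ}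
    (ha : a.length = n) : I.formulaEval quant W (c, a) = some true ↔
      ∃ φ : L.BoundedFormula Empty n, (quant = true ∨ φ.IsQF) ∧ formulaCode S φ = c ∧
        φ.Realize v (assignment a) := by
  constructor
  · intro h
    obtain ⟨φ, hφ, rfl⟩ := I.exists_formulaCode_eq quant W hW ha h
    obtain ⟨b, hb, hb'⟩ := I.formulaEval_formulaCode quant W hW' φ hφ v ha
    rw [h, Option.some.injEq] at hb
    exact ⟨φ, hφ, rfl, hb'.1 hb.symm⟩
  · rintro ⟨φ, hφ, rfl, h⟩
    obtain ⟨b, hb, hb'⟩ := I.formulaEval_formulaCode quant W hW' φ hφ v ha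
    rw [hb, hb'.2 h]

/-- The bound for the codes of the witnesses. -/
def witnessCode (c : ℕ) (a : List ℕ) : ℕ :=
  codeBound (witnessBound (level c) a.length (a.foldr (· + ·) 0 + 1))

theorem primrec_witnessCode : Primrec₂ witnessCode := by
  have hsum : Primrec fun a : List ℕ => a.foldr (· + ·) 0 + 1 :=
    Primrec.succ.comp (Primrec.list_foldr Primrec.id (Primrec.const 0)
      (Primrec.nat_add.comp (Primrec.fst.comp Primrec.snd) (Primrec.snd.comp Primrec.snd)).to₂)
  exact primrec_codeBound.comp (primrec_witnessBound (primrec_level.comp Primrec.fst)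
    (Primrec.list_length.comp Primrec.snd) (hsum.comp Primrec.snd))

/-- The rational with code k has height at most k + 1, so the sum of the codes plus 1 bounds the
heights in the assignment. `AtomicInvariant.forall_iff` then bounds the heights to be tested, and
`exists_code_lt` bounds their codes. -/
theorem isWitnessBound_witnessCode (hS : AtomicInvariant S) : IsWitnessBound S witnessCode := by
  refine ⟨fun _ _ => Nat.succ_pos _, fun a φ v h => ?_⟩
  have hA : 1 ≤ a.foldr (· + ·) 0 + 1 := Nat.le_add_left _ _
  have hle : ∀ i : Fin a.length,
      (ratMag (assignment a i)).height ≤ a.foldr (· + ·) 0 + 1 := by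
    intro i
    refine (height_ratVal_le _).trans (Nat.succ_le_succ ?_)
    have hmem : a.getD i 0 ∈ a := by
      rw [List.getD_eq_getElem _ _ i.2]; exact List.getElem_mem _
    exact List.single_le_sum (fun _ _ => Nat.zero_le _) _ hmem
  rw [hS.forall_iff φ v hA hle]
  intro x hx
  obtain ⟨k, hk, rfl⟩ := exists_code_lt ((Nat.one_le_pow _ _ hA).trans (Nat.le_add_right _ _)) hx
  exact h k hk

/-- Membership is tested by evaluating at the empty assignment. The result `some true` certifies
both that the number codes a sentence and that the sentence holds. -/
theorem decidableTheory (I : CodedInterpretation S) (hS : AtomicInvariant S) :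
    DecidableTheory S (L.completeTheory ℚ) := by
  have h : PrimrecPred fun m : ℕ => I.formulaEval true witnessCode (m, []) = some true :=
    Primrec.eq.comp ((I.primrec_formulaEval true witnessCode primrec_witnessCode).comp
      (Primrec.pair Primrec.id (Primrec.const []))) (Primrec.const (some true))
  refine PrimrecPred.computablePred (h.of_eq fun m => ?_)
  have hW := isWitnessBound_witnessCode hS
  rw [I.formulaEval_eq_some_true_iff true witnessCode hW.1 (fun _ => hW) default
    (n := 0) rfl]
  refine exists_congr fun φ => ?_
  have hr : φ.Realize (default : Empty → ℚ) (assignment []) ↔ φ ∈ L.completeTheory ℚ := by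
    rw [mem_completeTheory, Sentence.Realize, Formula.Realize]
    exact iff_of_eq (congrArg₂ φ.Realize (Subsingleton.elim _ _) (Subsingleton.elim _ _))
  rw [hr]
  tauto

/-- The evaluator is run with quantifiers rejected, so the witness bound plays no role and the
constant 1 serves. -/
theorem computablePred_isQF (I : CodedInterpretation S) : ComputablePred fun p : ℕ × List (ℤ × ℕ) =>
    ∃ φ : L.BoundedFormula Empty p.2.length, φ.IsQF ∧ formulaCode S φ = p.1 ∧
      φ.Realize (Empty.elim : Empty → ℚ) (fun i => fracVal (p.2.get i)) := by
  have h : PrimrecPred fun p : ℕ × List (ℤ × ℕ) =>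
      I.formulaEval false (fun _ _ => 1) (p.1, p.2.map fracCode) = some true :=
    Primrec.eq.comp ((I.primrec_formulaEval false (fun _ _ => 1) (Primrec₂.const 1)).comp
      (Primrec.pair Primrec.fst (Primrec.list_map Primrec.snd
        (primrec_fracCode.comp Primrec.snd).to₂))) (Primrec.const (some true))
  refine PrimrecPred.computablePred (h.of_eq fun p => ?_)
  rw [I.formulaEval_eq_some_true_iff false _ (fun _ _ => one_pos) (by simp)
    (Empty.elim : Empty → ℚ) (n := p.2.length) (by simp)]
  have hv : (assignment (p.2.map fracCode) : Fin p.2.length → ℚ) =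
      fun i => fracVal (p.2.get i) := by
    funext i
    rw [assignment, List.getD_eq_getElem _ _ (by simp), List.getElem_map, ratVal_fracCode]
    rfl
  simp [hv]

end CodedInterpretation

/-! ### The interpretations of the two languages on codes, and the theorem. -/

open Classical in
/-- The interpretation of `ℒ` on codes. -/
noncomputable def powInterpretation : CodedInterpretation powNumbering where
  fn i l :=
    if i = 0 ∧ l.length = 0 then some (ratMk 0 0 1)
    else if i = 1 ∧ l.length = 0 then some (ratMk 0 1 1)
    else if i = 2 ∧ l.length = 2 then some (mulCode (l.getD 0 0) (l.getD 1 0))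
    else if i = 3 ∧ l.length = 1 then some (invCode (l.getD 0 0))
    else none
  fn_primrec := by
    have h : ∀ i k : ℕ, PrimrecPred fun p : ℕ × List ℕ => p.1 = i ∧ p.2.length = k := fun i k =>
      (Primrec.eq.comp Primrec.fst (Primrec.const i)).and
        (Primrec.eq.comp (Primrec.list_length.comp Primrec.snd) (Primrec.const k))
    have hget : ∀ i : ℕ, Primrec fun p : ℕ × List ℕ => p.2.getD i 0 := fun i =>
      (Primrec.list_getD 0).comp Primrec.snd (Primrec.const i)
    exact Primrec.ite (h 0 0) (Primrec.const _) (Primrec.ite (h 1 0) (Primrec.const _)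
      (Primrec.ite (h 2 2) (Primrec.option_some.comp (primrec_mulCode.comp (hget 0) (hget 1)))
        (Primrec.ite (h 3 1) (Primrec.option_some.comp (primrec_invCode.comp (hget 0)))
          (Primrec.const none))))
  fn_spec := by
    rintro k f x
    cases f with
    | zero => exact ⟨ratMk 0 0 1, rfl, by rw [ratVal_ratMk]; simp; rfl⟩
    | one => exact ⟨ratMk 0 1 1, rfl, by rw [ratVal_ratMk]; simp; rfl⟩
    | mul => exact ⟨mulCode (x 0) (x 1), rfl, by rw [ratVal_mulCode]; rfl⟩
    | inv => exact ⟨invCode (x 0), rfl, by rw [ratVal_invCode]; rfl⟩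
  fn_some := by
    intro i l r h
    split_ifs at h with h0 h1 h2 h3
    · rw [h0.1, h0.2]; exact ⟨PowFunc.zero, rfl⟩
    · rw [h1.1, h1.2]; exact ⟨PowFunc.one, rfl⟩
    · rw [h2.1, h2.2]; exact ⟨PowFunc.mul, rfl⟩
    · rw [h3.1, h3.2]; exact ⟨PowFunc.inv, rfl⟩
  rel i l :=
    if i = 0 ∧ l.length = 2 then some (decide (LtCode (l.getD 0 0) (l.getD 1 0)))
    else if 2 ≤ i ∧ l.length = 1 then
      some (decide (∃ y : ℚ, ratVal (l.getD 0 0) = y ^ i))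
    else none
  rel_primrec := by
    have hget : ∀ i : ℕ, Primrec fun p : ℕ × List ℕ => p.2.getD i 0 := fun i =>
      (Primrec.list_getD 0).comp Primrec.snd (Primrec.const i)
    have hlen : ∀ k : ℕ, PrimrecPred fun p : ℕ × List ℕ => p.2.length = k := fun k =>
      Primrec.eq.comp (Primrec.list_length.comp Primrec.snd) (Primrec.const k)
    have hlt : PrimrecPred fun p : ℕ × List ℕ => LtCode (p.2.getD 0 0) (p.2.getD 1 0) :=
      primrecRel_ltCode.comp (hget 0) (hget 1)
    have hpow : PrimrecPred fun p : ℕ × List ℕ => ∃ y : ℚ, ratVal (p.2.getD 0 0) = y ^ p.1 :=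
      primrecRel_isPow.comp Primrec.fst (hget 0)
    exact Primrec.ite ((Primrec.eq.comp Primrec.fst (Primrec.const 0)).and (hlen 2))
      (Primrec.option_some.comp hlt.decide)
      (Primrec.ite ((Primrec.nat_le.comp (Primrec.const 2) Primrec.fst).and (hlen 1))
        (Primrec.option_some.comp hpow.decide) (Primrec.const none))
  rel_spec := by
    rintro k R x
    cases R with
    | lt =>
      refine ⟨decide (LtCode (x 0) (x 1)), rfl, ?_⟩
      rw [decide_eq_true_iff, ltCode_iff]
      rfl
    | isPow m hm =>
      refine ⟨decide (∃ y : ℚ, ratVal (x 0) = y ^ m), ?_, ?_⟩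
      · have h0 : powNumbering.rel ⟨1, PowRel.isPow m hm⟩ = m := rfl
        rw [h0, if_neg (by omega), if_pos (by simpa using hm)]
        rfl
      · rw [decide_eq_true_iff]
        rfl
  rel_some := by
    intro i l r h
    split_ifs at h with h0 h1
    · rw [h0.1, h0.2]; exact ⟨PowRel.lt, rfl⟩
    · rw [h1.2]; exact ⟨PowRel.isPow i h1.1, rfl⟩

/-- The interpretation of `⟨·, ≤⟩` on codes. -/
def mulOrdInterpretation : CodedInterpretation mulOrdNumbering where
  fn i l := if i = 0 ∧ l.length = 2 then some (mulCode (l.getD 0 0) (l.getD 1 0)) else none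
  fn_primrec := by
    have hget : ∀ i : ℕ, Primrec fun p : ℕ × List ℕ => p.2.getD i 0 := fun i =>
      (Primrec.list_getD 0).comp Primrec.snd (Primrec.const i)
    exact Primrec.ite ((Primrec.eq.comp Primrec.fst (Primrec.const 0)).and
      (Primrec.eq.comp (Primrec.list_length.comp Primrec.snd) (Primrec.const 2)))
      (Primrec.option_some.comp (primrec_mulCode.comp (hget 0) (hget 1))) (Primrec.const none)
  fn_spec := by
    rintro k f x
    cases f with
    | mul => exact ⟨mulCode (x 0) (x 1), rfl, by rw [ratVal_mulCode]; rfl⟩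
  fn_some := by
    intro i l r h
    split_ifs at h with h0
    rw [h0.1, h0.2]; exact ⟨MulOrdFunc.mul, rfl⟩
  rel i l :=
    if i = 0 ∧ l.length = 2 then some (decide (¬ LtCode (l.getD 1 0) (l.getD 0 0))) else none
  rel_primrec := by
    have hget : ∀ i : ℕ, Primrec fun p : ℕ × List ℕ => p.2.getD i 0 := fun i =>
      (Primrec.list_getD 0).comp Primrec.snd (Primrec.const i)
    have hle : PrimrecPred fun p : ℕ × List ℕ => ¬ LtCode (p.2.getD 1 0) (p.2.getD 0 0) :=
      PrimrecPred.not (primrecRel_ltCode.comp (hget 1) (hget 0))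
    exact Primrec.ite ((Primrec.eq.comp Primrec.fst (Primrec.const 0)).and
      (Primrec.eq.comp (Primrec.list_length.comp Primrec.snd) (Primrec.const 2)))
      (Primrec.option_some.comp hle.decide) (Primrec.const none)
  rel_spec := by
    rintro k R x
    cases R with
    | le =>
      refine ⟨decide (¬ LtCode (x 1) (x 0)), rfl, ?_⟩
      rw [decide_eq_true_iff, ltCode_iff, not_lt]
      rfl
  rel_some := by
    intro i l r h
    split_ifs at h with h0
    rw [h0.1, h0.2]; exact ⟨MulOrdRel.le, rfl⟩

theorem mainTheorem3 :
    -- the structure `⟨ℚ, ℒ⟩` admits quantifier elimination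
    AdmitsQE powLang ℚ ∧
    -- one can decide whether a given rational is an `n`-th power of a rational
    (ComputablePred fun p : (ℤ × ℕ) × ℕ => ∃ y : ℚ, fracVal p.1 = y ^ p.2) ∧
    -- one can decide whether a given quantifier-free formula of `ℒ` holds at a given tuple of
    -- rationals (for the empty tuple: whether a given quantifier-free sentence is true)
    (ComputablePred fun p : ℕ × List (ℤ × ℕ) =>
      ∃ φ : powLang.BoundedFormula Empty p.2.length, φ.IsQF ∧ formulaCode powNumbering φ = p.1 ∧
        φ.Realize (Empty.elim : Empty → ℚ) (fun i => fracVal (p.2.get i))) ∧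
    -- the theories of `⟨ℚ, ℒ⟩` and of `⟨ℚ, ·, ≤⟩` are decidable
    DecidableTheory powNumbering (powLang.completeTheory ℚ) ∧
    DecidableTheory mulOrdNumbering (mulOrdLang.completeTheory ℚ) ∧
    -- addition is not definable (without parameters) in `⟨ℚ, ·, ≤⟩`
    ¬ (∅ : Set ℚ).Definable mulOrdLang {v : Fin 3 → ℚ | v 0 + v 1 = v 2} := by
  exact ⟨quantifierElimination_powLang, computablePred_isPow, powInterpretation.computablePred_isQF,
    powInterpretation.decidableTheory atomicInvariant_powNumbering,
    mulOrdInterpretation.decidableTheory atomicInvariant_mulOrdNumbering, not_definable_add⟩
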